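/- Let $N\ge 0$, $q\in\mathbb C\setminus\{0\}$ with $q^2\neq 1$, and $\eta_1,\dots,\eta_N\in\mathbb C\setminus\{0\}$ with $\eta_a\neq\pm q^{j}\eta_b$ for all $a<b$ and $j\in\{-1,0,1\}$. On $\mathcal R_N=(\mathbb C^2)^{\otimes N}$, with Pauli matrices $\sigma_n^z$, $\sigma_n^\pm=(\sigma_n^x\pm i\sigma_n^y)/2$ at site $n$, define for $\lambda\in\mathbb C\setminus\{0\}$ $$L_n(\lambda)=\begin{pmatrix}x_+(\lambda)+x_-(\lambda)\sigma_n^z&(q-q^{-1})\sigma_n^-\\(q-q^{-1})\sigma_n^+&x_+(\lambda)-x_-(\lambda)\sigma_n^z\end{pmatrix},\qquad x_\pm(\lambda)=\tfrac12\big(\lambda q-(\lambda q)^{-1}\pm(\lambda-\lambda^{-1})\big),$$ $$\begin{pmatrix}A(\lambda)&B(\lambda)\\C(\lambda)&D(\lambda)\end{pmatrix}=L_N(\lambda/\eta_N)\cdots L_1(\lambda/\eta_1),$$ $$a(\lambda)=-\prod_{n=1}^N\Big(\frac{\lambda q}{\eta_n}-\frac{\eta_n}{\lambda q}\Big),\qquad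 d(\lambda)=\prod_{n=1}^N\Big(\frac{\lambda}{\eta_n}-\frac{\eta_n}{\lambda}\Big).$$ Let $|0\rangle\in\mathcal R_N$ be the all-spins-up vector, $\langle 0|$ the corresponding element of the dual basis of $\mathcal L_N=\mathcal R_N^*$, and let $\mathrm n$ be either square root of $\prod_{1\le b<a\le N}(\eta_a/\eta_b-\eta_b/\eta_a)$. For $\mathbf h=(h_1,\dots,h_N)\in\{0,1\}^N$ put $$\langle \mathbf h\|=\frac1{\mathrm n}\langle 0|\prod_{n=1}^N\Big(\frac{C(\eta_n/q)}{d(\eta_n/q)}\Big)^{h_n},\qquad \|\mathbf h\rangle=\frac1{\mathrm n}\prod_{n=1}^N\Big(\frac{B(\eta_n/q)}{a(\eta_n)}\Big)^{h_n}|0\rangle,$$ $$a_{\mathbf h}(\lambda)=\prod_{n=1}^N\Big(\frac{\lambda q^{1-h_n}}{\eta_n}-\frac{\eta_n}{\lambda q^{1-h_n}}\Big),\qquad w_{a,\mathbf h}(\lambda)=\prod_{b\ne a}\frac{\lambda q^{1-h_b}/\eta_b-\eta_b/(\lambda q^{1-h_b})}{\eta_aq^{h_a-h_b}/\eta_b-\eta_b/(\eta_aq^{h_a-h_b})}.$$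 Write $\langle\mathbf h\|T_a^{\pm}$ and $T_a^{\pm}\|\mathbf h\rangle$ for the states with $h_a$ replaced by $h_a\pm1$ (below, terms with $h_a\pm1\notin\{0,1\}$ have coefficient $0$ and are omitted). Then the following hold for all $\lambda\ne0$ and all $\mathbf h$. I) The covectors $\langle\mathbf h\|$ form a basis of $\mathcal L_N$, and $$\langle\mathbf h\|A(\lambda)=a_{\mathbf h}(\lambda)\langle\mathbf h\|,$$ $$\langle\mathbf h\|C(\lambda)=\sum_{a=1}^N w_{a,\mathbf h}(\lambda)\,d(\eta_aq^{h_a-1})\,\langle\mathbf h\|T_a^+,\qquad \langle\mathbf h\|B(\lambda)=\sum_{a=1}^N w_{a,\mathbf h}(\lambda)\,a(\eta_aq^{h_a-1})\,\langle\mathbf h\|T_a^-.$$ II) The vectors $\|\mathbf h\rangle$ form a basis of $\mathcal R_N$, and $$A(\lambda)\|\mathbf h\rangle=a_{\mathbf h}(\lambda)\|\mathbf h\rangle,$$ $$C(\lambda)\|\mathbf h\rangle=\sum_{a=1}^N w_{a,\mathbf h}(\lambda)\,d(\eta_aq^{-h_a})\,T_a^-\|\mathbf h\rangle,\qquad B(\lambda)\|\mathbf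 h\rangle=\sum_{a=1}^N w_{a,\mathbf h}(\lambda)\,a(\eta_aq^{-h_a})\,T_a^+\|\mathbf h\rangle.$$ The functions $a_{\mathbf h}$, $\mathbf h\in\{0,1\}^N$, are pairwise distinct on $\mathbb C\setminus\{0\}$. In both representations $D$ is uniquely determined by the quantum determinant relation $$A(\lambda)D(\lambda/q)-B(\lambda)C(\lambda/q)=-a(\lambda)\,d(\lambda/q)\,\mathbb I .$$ That is, $D$ satisfies it for all $\lambda\neq0$; if $\lambda\ne0$ and $a_{\mathbf h}(\lambda)\neq0$ for all $\mathbf h$, then $D(\lambda/q)$ is the only operator $Y$ with $A(\lambda)Y-B(\lambda)C(\lambda/q)=-a(\lambda)d(\lambda/q)\mathbb I$; and $D$ is the only continuous operator-valued function on $\mathbb C\setminus\{0\}$ that satisfies the relation for all $\lambda\neq0$. -/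

import Mathlib

open scoped Matrix

noncomputable section

namespace XXZ

/-- The function `u ↦ u - u⁻¹`, by which every factor below is written. -/
def sn (u : ℂ) : ℂ := u - u⁻¹

/-! ### The chain -/

/-- Labels of the standard spin basis of `R_1 ⊗ ⋯ ⊗ R_N`, with `R_n = ℂ²`:
at each site `0` stands for spin `k = +1` and `1` for spin `k = -1`. -/
abbrev Conf (N : ℕ) : Type := Fin N → Fin 2

/-- Operators on `R_1 ⊗ ⋯ ⊗ R_N`, as matrices in the spin basis. They act on vectors
(columns) by `*ᵥ` and on covectors (rows, in the dual spin basis) by `ᵥ*`. -/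
abbrev Op (N : ℕ) : Type := Matrix (Conf N) (Conf N) ℂ

def sigmaZ : Matrix (Fin 2) (Fin 2) ℂ := !![1, 0; 0, -1]

/-- The raising operator `(σˣ + i σʸ) / 2`. -/
def sigmaPlus : Matrix (Fin 2) (Fin 2) ℂ := !![0, 1; 0, 0]

/-- The lowering operator `(σˣ - i σʸ) / 2`. -/
def sigmaMinus : Matrix (Fin 2) (Fin 2) ℂ := !![0, 0; 1, 0]

/-- `1 ⊗ ⋯ ⊗ 1 ⊗ m ⊗ 1 ⊗ ⋯ ⊗ 1`, with the factor `m` at site `n`. -/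
def siteOp {N : ℕ} (n : Fin N) (m : Matrix (Fin 2) (Fin 2) ℂ) : Op N :=
  fun s t => ∏ k, (if k = n then m else 1) (s k) (t k)

def xPlus (q x : ℂ) : ℂ := (sn (x * q) + sn x) / 2

def xMinus (q x : ℂ) : ℂ := (sn (x * q) - sn x) / 2

/-- The Lax operator `L_{0n}(x)`: a `2 × 2` matrix in the auxiliary space whose entries are
operators on the chain that act at site `n`. -/
def lax {N : ℕ} (q : ℂ) (n : Fin N) (x : ℂ) : Matrix (Fin 2) (Fin 2) (Op N) :=
  !![siteOp n (xPlus q x • 1 + xMinus q x • sigmaZ), siteOp n ((q - q⁻¹) • sigmaMinus);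
     siteOp n ((q - q⁻¹) • sigmaPlus), siteOp n (xPlus q x • 1 - xMinus q x • sigmaZ)]

/-- The monodromy matrix `L_{0N}(x / η_N) ⋯ L_{01}(x / η_1)`. -/
def monodromy {N : ℕ} (q : ℂ) (η : Fin N → ℂ) (x : ℂ) : Matrix (Fin 2) (Fin 2) (Op N) :=
  (List.ofFn fun n => lax q n (x / η n)).reverse.prod

def opA {N : ℕ} (q : ℂ) (η : Fin N → ℂ) (x : ℂ) : Op N := monodromy q η x 0 0
def opB {N : ℕ} (q : ℂ) (η : Fin N → ℂ) (x : ℂ) : Op N := monodromy q η x 0 1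
def opC {N : ℕ} (q : ℂ) (η : Fin N → ℂ) (x : ℂ) : Op N := monodromy q η x 1 0
def opD {N : ℕ} (q : ℂ) (η : Fin N → ℂ) (x : ℂ) : Op N := monodromy q η x 1 1

/-! ### Scalar functions -/

/-- `a(x) = - ∏ₙ (x q / ηₙ - ηₙ / (x q))`. -/
def aFun {N : ℕ} (q : ℂ) (η : Fin N → ℂ) (x : ℂ) : ℂ := -∏ n, sn (x * q / η n)

/-- `d(x) = ∏ₙ (x / ηₙ - ηₙ / x)`. -/
def dFun {N : ℕ} (η : Fin N → ℂ) (x : ℂ) : ℂ := ∏ n, sn (x / η n)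

/-- The integer `h_n ∈ {0, 1}`. -/
abbrev hInt {N : ℕ} (h : Fin N → Fin 2) (n : Fin N) : ℤ := ((h n : ℕ) : ℤ)

/-- `a_h(x) = ∏ₙ (x q^(1 - hₙ) / ηₙ - ηₙ / (x q^(1 - hₙ)))`. -/
def aEig {N : ℕ} (q : ℂ) (η : Fin N → ℂ) (h : Fin N → Fin 2) (x : ℂ) : ℂ :=
  ∏ n, sn (x * q ^ (1 - hInt h n) / η n)

/-- The interpolation coefficient
`∏_{b ≠ a} (x q^(1 - h_b) / η_b - η_b / (q^(1 - h_b) x)) /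
  (η_a q^(h_a - h_b) / η_b - η_b / (q^(h_a - h_b) η_a))`. -/
def interp {N : ℕ} (q : ℂ) (η : Fin N → ℂ) (h : Fin N → Fin 2) (a : Fin N) (x : ℂ) : ℂ :=
  ∏ b ∈ Finset.univ.erase a,
    sn (x * q ^ (1 - hInt h b) / η b) / sn (η a * q ^ (hInt h a - hInt h b) / η b)

/-- The square `∏_{b < a} (η_a / η_b - η_b / η_a)` of the normalization factor. -/
def normSq {N : ℕ} (η : Fin N → ℂ) : ℂ :=
  ∏ a, ∏ b ∈ Finset.univ.filter (fun b => b < a), sn (η a / η b)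

/-! ### The states -/

/-- The reference state, all spins up; the same coordinates describe the vector `|0⟩` in the
spin basis and the covector `⟨0|` in the dual spin basis. -/
def refState (N : ℕ) : Conf N → ℂ := Pi.single (fun _ => 0) 1

/-- The covector `(1 / nrm) ⟨0| ∏ₙ (C(ηₙ / q) / d(ηₙ / q))^{hₙ}`. -/
def leftState {N : ℕ} (q : ℂ) (η : Fin N → ℂ) (nrm : ℂ) (h : Fin N → Fin 2) : Conf N → ℂ :=
  nrm⁻¹ • (refState N ᵥ*
    (List.ofFn fun n => ((dFun η (η n / q))⁻¹ • opC q η (η n / q)) ^ (h n : ℕ)).prod)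

/-- The vector `(1 / nrm) ∏ₙ (B(ηₙ / q) / a(ηₙ))^{hₙ} |0⟩`. -/
def rightState {N : ℕ} (q : ℂ) (η : Fin N → ℂ) (nrm : ℂ) (h : Fin N → Fin 2) : Conf N → ℂ :=
  nrm⁻¹ • ((List.ofFn fun n => ((aFun q η (η n))⁻¹ • opB q η (η n / q)) ^ (h n : ℕ)).prod *ᵥ
    refState N)

/-- `T_a⁺`: the member of the family `ψ` with `h_a` replaced by `h_a + 1`. If `h_a = 1` there is
no such member and the value is set to `0`; in the formulas of the theorem it is then multiplied
by `d(η_a) = 0` or by `a(η_a / q) = 0`. -/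
def shiftUp {N : ℕ} {V : Type*} [Zero V] (ψ : (Fin N → Fin 2) → V) (a : Fin N)
    (h : Fin N → Fin 2) : V :=
  if h a = 0 then ψ (Function.update h a 1) else 0

/-- `T_a⁻`: the member of the family `ψ` with `h_a` replaced by `h_a - 1`. If `h_a = 0` there is
no such member and the value is set to `0`; in the formulas of the theorem it is then multiplied
by `a(η_a / q) = 0` or by `d(η_a) = 0`. -/
def shiftDown {N : ℕ} {V : Type*} [Zero V] (ψ : (Fin N → Fin 2) → V) (a : Fin N)
    (h : Fin N → Fin 2) : V :=
  if h a = 1 then ψ (Function.update h a 0) else 0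

theorem dFun_self {N : ℕ} (η : Fin N → ℂ) (hη : ∀ n, η n ≠ 0) (a : Fin N) :
    dFun η (η a) = 0 :=
  Finset.prod_eq_zero (Finset.mem_univ a) (by simp [sn, hη a])

theorem aFun_div {N : ℕ} (q : ℂ) (hq : q ≠ 0) (η : Fin N → ℂ) (hη : ∀ n, η n ≠ 0) (a : Fin N) :
    aFun q η (η a / q) = 0 := by
  have h : ∏ n, sn (η a / q * q / η n) = 0 :=
    Finset.prod_eq_zero (Finset.mem_univ a) (by simp [sn, hη a, hq])
  simp [aFun, h]

end XXZ

end

/-! The states are joint eigenvectors of the operators `A(x)`, and an eigenvalue function is encoded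
in its zeros: one node per site, `η_a / q` if `h_a = 0` and `η_a` if `h_a = 1`. Two properties of
the monodromy matrix drive the proof: the exchange relation with the six-vertex `R`-matrix
(`isExchange_monodromy`) and the quantum determinant (`monodromy_mul_adj`). Both are checked at one
site and propagate along the chain because operators at different sites commute.

Let `ζ_a` be a zero of the eigenvalue of `v`. The exchange relation of `A(x)` with `B(ζ_a)` or
`C(ζ_a)` then loses its unwanted term on `v`, and the rest says that the zero moves to `ζ_a q` or
`ζ_a / q` (`mulVec_mulVec_of_exchange`). From the reference state, whose nodes are all `η_a / q`,
such moves produce the `2^N` states. None vanishes, since by the quantum determinant the opposite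
operator undoes each move up to a nonzero scalar (`lower_raise`). Genericity makes the eigenvalue
functions distinct, hence separated at a single `x`, and the states form a basis. A move to a value
that is no node must therefore give zero (`raise_eq_zero`, `lower_eq_zero`). This settles the action
of `B` and `C` at the nodes, and since their entries are Laurent polynomials with only `N` free
coefficients, Lagrange interpolation gives the action at every `x` (`mulVec_eq_sum_interp`).

The left representation is the same argument for the transposed operators, with `B` and `C`
interchanged; `IsSeparating` collects what the argument uses, so that it runs once. Finally `A(x)`
can be cancelled where no eigenvalue vanishes, so the quantum determinant fixes `D` there, and
continuity fixes it everywhere. -/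

noncomputable section

namespace XXZ

/-! ### Operators at one site -/

/-- The product operator `⨂ₖ m k`. -/
def tensorOp {N : ℕ} (m : Fin N → Matrix (Fin 2) (Fin 2) ℂ) : Op N :=
  fun s t => ∏ k, m k (s k) (t k)

theorem tensorOp_mul {N : ℕ} (m m' : Fin N → Matrix (Fin 2) (Fin 2) ℂ) :
    tensorOp m * tensorOp m' = tensorOp (m * m') := by
  ext s t
  simp only [tensorOp, Matrix.mul_apply, Pi.mul_apply, ← Finset.prod_mul_distrib]
  rw [Finset.prod_univ_sum, Fintype.piFinset_univ]

theorem tensorOp_one {N : ℕ} : tensorOp (1 : Fin N → Matrix (Fin 2) (Fin 2) ℂ) = 1 := by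
  ext s t
  simp only [tensorOp, Pi.one_apply, Matrix.one_apply, Finset.prod_ite_zero, funext_iff]
  simp

theorem siteOp_eq_tensorOp {N : ℕ} (n : Fin N) (m : Matrix (Fin 2) (Fin 2) ℂ) :
    siteOp n m = tensorOp (Pi.mulSingle n m) := by
  ext s t
  refine Finset.prod_congr rfl fun k _ => ?_
  simp [Pi.mulSingle_apply]

theorem siteOp_eq_mul_prod {N : ℕ} (n : Fin N) (m : Matrix (Fin 2) (Fin 2) ℂ) (s t : Conf N) :
    siteOp n m s t = m (s n) (t n) *
      ∏ k ∈ Finset.univ.erase n, (1 : Matrix (Fin 2) (Fin 2) ℂ) (s k) (t k) := by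
  rw [siteOp, ← Finset.mul_prod_erase _ _ (Finset.mem_univ n)]
  congr 1
  · simp
  · exact Finset.prod_congr rfl fun k hk => by rw [if_neg (Finset.ne_of_mem_erase hk)]

/-- `siteOp n` as a homomorphism of algebras. -/
def siteHom {N : ℕ} (n : Fin N) : Matrix (Fin 2) (Fin 2) ℂ →ₐ[ℂ] Op N :=
  AlgHom.ofLinearMap
    { toFun := siteOp n
      map_add' := fun m m' => by
        ext s t
        simp only [siteOp_eq_mul_prod, Matrix.add_apply, add_mul]
      map_smul' := fun c m => by
        ext s t
        simp only [siteOp_eq_mul_prod, Matrix.smul_apply, smul_eq_mul, mul_assoc,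
          RingHom.id_apply] }
    (by simp [siteOp_eq_tensorOp, Pi.mulSingle_one, tensorOp_one])
    (fun m m' => by simp [siteOp_eq_tensorOp, tensorOp_mul, Pi.mulSingle_mul])

theorem siteHom_apply {N : ℕ} (n : Fin N) (m : Matrix (Fin 2) (Fin 2) ℂ) :
    siteHom n m = siteOp n m := rfl

theorem commute_siteHom {N : ℕ} {n n' : Fin N} (h : n ≠ n') (m m' : Matrix (Fin 2) (Fin 2) ℂ) :
    Commute (siteHom n m) (siteHom n' m') := by
  simp only [siteHom_apply, siteOp_eq_tensorOp, Commute, SemiconjBy, tensorOp_mul]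
  rw [(Pi.mulSingle_commute (f := fun _ : Fin N => Matrix (Fin 2) (Fin 2) ℂ) h m m').eq]

theorem siteOp_transpose {N : ℕ} (n : Fin N) (m : Matrix (Fin 2) (Fin 2) ℂ) :
    (siteOp n m)ᵀ = siteOp n mᵀ := by
  ext s t
  simp only [siteOp, Matrix.transpose_apply]
  refine Finset.prod_congr rfl fun k _ => ?_
  split_ifs
  · rfl
  · rw [Matrix.one_apply, Matrix.one_apply]; simp [eq_comm]

/-- The Lax operator of a chain of one site. -/
def lax₀ (q x : ℂ) : Matrix (Fin 2) (Fin 2) (Matrix (Fin 2) (Fin 2) ℂ) :=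
  !![!![sn (x * q), 0; 0, sn x], !![0, 0; sn q, 0];
     !![0, sn q; 0, 0], !![sn x, 0; 0, sn (x * q)]]

/-- Reduces every identity for Lax operators to a finite computation with constant matrices, to be
transported along the algebra homomorphism `siteHom n`. -/
theorem lax_eq_map {N : ℕ} (q : ℂ) (n : Fin N) (x : ℂ) :
    lax q n x = (lax₀ q x).map (siteHom n) := by
  have h1 : xPlus q x • (1 : Matrix (Fin 2) (Fin 2) ℂ) + xMinus q x • sigmaZ
      = !![sn (x * q), 0; 0, sn x] := by
    ext i j; fin_cases i <;> fin_cases j <;> simp [xPlus, xMinus, sigmaZ] <;> ring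
  have h2 : xPlus q x • (1 : Matrix (Fin 2) (Fin 2) ℂ) - xMinus q x • sigmaZ
      = !![sn x, 0; 0, sn (x * q)] := by
    ext i j; fin_cases i <;> fin_cases j <;> simp [xPlus, xMinus, sigmaZ] <;> ring
  have h3 : (q - q⁻¹) • sigmaMinus = !![0, 0; sn q, 0] := by
    ext i j; fin_cases i <;> fin_cases j <;> simp [sigmaMinus, sn]
  have h4 : (q - q⁻¹) • sigmaPlus = !![0, sn q; 0, 0] := by
    ext i j; fin_cases i <;> fin_cases j <;> simp [sigmaPlus, sn]
  rw [lax, h1, h2, h3, h4]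
  ext1 i j
  fin_cases i <;> fin_cases j <;> rfl

/-! ### Two-by-two matrices over an algebra: exchange relations and quantum determinant -/

section Exchange

variable {E F : Type*} [Ring E]

/-- `T ⊗ 1` in the tensor square of the auxiliary space. -/
def auxFst (T : Matrix (Fin 2) (Fin 2) E) : Matrix (Fin 2 × Fin 2) (Fin 2 × Fin 2) E :=
  fun p r => if p.2 = r.2 then T p.1 r.1 else 0

/-- `1 ⊗ T` in the tensor square of the auxiliary space. -/
def auxSnd (T : Matrix (Fin 2) (Fin 2) E) : Matrix (Fin 2 × Fin 2) (Fin 2 × Fin 2) E :=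
  fun p r => if p.1 = r.1 then T p.2 r.2 else 0

theorem auxFst_mul (T T' : Matrix (Fin 2) (Fin 2) E) :
    auxFst (T * T') = auxFst T * auxFst T' := by
  ext ⟨i, k⟩ ⟨j, l⟩
  simp [auxFst, Matrix.mul_apply, Fintype.sum_prod_type]

theorem auxSnd_mul (T T' : Matrix (Fin 2) (Fin 2) E) :
    auxSnd (T * T') = auxSnd T * auxSnd T' := by
  ext ⟨i, k⟩ ⟨j, l⟩
  by_cases h : i = j <;>
    simp [auxSnd, Matrix.mul_apply, Fintype.sum_prod_type, h]

theorem auxFst_mul_auxSnd_apply (T S : Matrix (Fin 2) (Fin 2) E) (i k j l : Fin 2) :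
    (auxFst T * auxSnd S) (i, k) (j, l) = T i j * S k l := by
  simp [auxFst, auxSnd, Matrix.mul_apply, Fintype.sum_prod_type]

theorem auxSnd_mul_auxFst_apply (T S : Matrix (Fin 2) (Fin 2) E) (i k j l : Fin 2) :
    (auxSnd S * auxFst T) (i, k) (j, l) = S k l * T i j := by
  simp [auxFst, auxSnd, Matrix.mul_apply, Fintype.sum_prod_type]

theorem auxFst_mul_auxSnd_comm {T S : Matrix (Fin 2) (Fin 2) E}
    (h : ∀ i j k l, Commute (T i j) (S k l)) :
    auxFst T * auxSnd S = auxSnd S * auxFst T := by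
  ext ⟨i, k⟩ ⟨j, l⟩
  rw [auxFst_mul_auxSnd_apply, auxSnd_mul_auxFst_apply, (h _ _ _ _).eq]

/-- The adjugate of a two-by-two matrix over a ring. -/
def adj (S : Matrix (Fin 2) (Fin 2) E) : Matrix (Fin 2) (Fin 2) E :=
  !![S 1 1, -S 0 1; -S 1 0, S 0 0]

/-- Entries need to commute only across the two factors, not within either of them. Operators at
different sites satisfy this, so that quantum determinants telescope along the chain. -/
theorem adj_mul {S S' : Matrix (Fin 2) (Fin 2) E}
    (hc : ∀ i j k l, Commute (S i j) (S' k l)) : adj (S * S') = adj S' * adj S := by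
  ext i j
  fin_cases i <;> fin_cases j <;>
    simp [adj, Matrix.mul_apply, Fin.sum_univ_two, (hc _ _ _ _).eq] <;> abel

variable [Algebra ℂ E] [Ring F] [Algebra ℂ F]

variable (E) in
/-- The six-vertex `R`-matrix with scalar entries in `E`. -/
def rMat (q x : ℂ) : Matrix (Fin 2 × Fin 2) (Fin 2 × Fin 2) E :=
  fun p r => algebraMap ℂ E
    (if p = r then (if p.1 = p.2 then sn (x * q) else sn x)
      else if p = r.swap then sn q else 0)

/-- The exchange relation `R (T ⊗ 1) (1 ⊗ S) = (1 ⊗ S) (T ⊗ 1) R`. -/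
def IsExchange (q x : ℂ) (T S : Matrix (Fin 2) (Fin 2) E) : Prop :=
  rMat E q x * (auxFst T * auxSnd S) = auxSnd S * auxFst T * rMat E q x

/-- The usual train argument: `T'` passes `S`, the two exchange relations carry `R` through, and `T`
passes `S'`. -/
theorem IsExchange.mul {q x : ℂ} {T S T' S' : Matrix (Fin 2) (Fin 2) E}
    (h : IsExchange q x T S) (h' : IsExchange q x T' S')
    (hc : ∀ i j k l, Commute (T' i j) (S k l)) (hc' : ∀ i j k l, Commute (T i j) (S' k l)) :
    IsExchange q x (T * T') (S * S') := by
  have e1 := auxFst_mul_auxSnd_comm hc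
  have e2 := auxFst_mul_auxSnd_comm hc'
  unfold IsExchange at *
  calc rMat E q x * (auxFst (T * T') * auxSnd (S * S'))
      = rMat E q x * (auxFst T * (auxFst T' * auxSnd S) * auxSnd S') := by
        simp only [auxFst_mul, auxSnd_mul, mul_assoc]
    _ = rMat E q x * (auxFst T * auxSnd S) * (auxFst T' * auxSnd S') := by
        rw [e1]; simp only [mul_assoc]
    _ = auxSnd S * auxFst T * (rMat E q x * (auxFst T' * auxSnd S')) := by
        rw [h]; simp only [mul_assoc]
    _ = auxSnd S * (auxFst T * auxSnd S') * auxFst T' * rMat E q x := by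
        rw [h']; simp only [mul_assoc]
    _ = _ := by rw [e2]; simp only [auxFst_mul, auxSnd_mul, mul_assoc]

theorem IsExchange.one (q x : ℂ) : IsExchange q x (1 : Matrix (Fin 2) (Fin 2) E) 1 := by
  have h1 : auxFst (1 : Matrix (Fin 2) (Fin 2) E) = 1 := by
    ext ⟨i, k⟩ ⟨j, l⟩
    simp only [auxFst, Matrix.one_apply, Prod.mk.injEq, ← ite_and, and_comm]
  have h2 : auxSnd (1 : Matrix (Fin 2) (Fin 2) E) = 1 := by
    ext ⟨i, k⟩ ⟨j, l⟩
    simp only [auxSnd, Matrix.one_apply, Prod.mk.injEq, ← ite_and]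
  simp [IsExchange, h1, h2]

theorem IsExchange.map {q x : ℂ} {T S : Matrix (Fin 2) (Fin 2) E} (h : IsExchange q x T S)
    (φ : E →ₐ[ℂ] F) : IsExchange q x (T.map φ) (S.map φ) := by
  have h1 (T : Matrix (Fin 2) (Fin 2) E) : auxFst (T.map φ) = (auxFst T).map φ := by
    ext p r; simp [auxFst, apply_ite φ]
  have h2 (T : Matrix (Fin 2) (Fin 2) E) : auxSnd (T.map φ) = (auxSnd T).map φ := by
    ext p r; simp [auxSnd, apply_ite φ]
  have h3 : rMat F q x = (rMat E q x).map φ := by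
    ext p r; simp [rMat]
  unfold IsExchange at *
  rw [h1, h2, h3, ← Matrix.map_mul, ← Matrix.map_mul, ← Matrix.map_mul, ← Matrix.map_mul, h]

/-- The components of the exchange relation used below. -/
theorem IsExchange.entries {q x : ℂ} {T S : Matrix (Fin 2) (Fin 2) E} (h : IsExchange q x T S) :
    sn x • (T 0 0 * S 1 0) + sn q • (T 1 0 * S 0 0) = sn (x * q) • (S 1 0 * T 0 0) ∧
    sn x • (T 1 0 * S 0 0) + sn q • (T 0 0 * S 1 0) = sn (x * q) • (S 0 0 * T 1 0) ∧
    sn (x * q) • (T 0 0 * S 0 1) = sn x • (S 0 1 * T 0 0) + sn q • (S 0 0 * T 0 1) ∧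
    sn (x * q) • (T 0 1 * S 0 0) = sn x • (S 0 0 * T 0 1) + sn q • (S 0 1 * T 0 0) ∧
    sn (x * q) • (T 1 0 * S 1 0) = sn (x * q) • (S 1 0 * T 1 0) ∧
    sn (x * q) • (T 0 1 * S 0 1) = sn (x * q) • (S 0 1 * T 0 1) ∧
    sn x • (T 0 0 * S 1 1) + sn q • (T 1 0 * S 0 1)
      = sn x • (S 1 1 * T 0 0) + sn q • (S 1 0 * T 0 1) := by
  have key := fun p r => congrFun (congrFun h p) r
  simp only [Matrix.mul_apply (M := rMat E q x), Matrix.mul_apply (N := rMat E q x),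
    Fintype.sum_prod_type, Fin.sum_univ_two] at key
  have k1 := key (0, 1) (0, 0)
  have k2 := key (1, 0) (0, 0)
  have k3 := key (0, 0) (0, 1)
  have k4 := key (0, 0) (1, 0)
  have k5 := key (1, 1) (0, 0)
  have k6 := key (0, 0) (1, 1)
  have k7 := key (0, 1) (0, 1)
  simp [rMat, ← Algebra.commutes, ← Algebra.smul_def, auxFst_mul_auxSnd_apply,
    auxSnd_mul_auxFst_apply] at k1 k2 k3 k4 k5 k6 k7
  refine ⟨k1, ?_, ?_, ?_, k5, k6, ?_⟩
  · rw [← k2, add_comm]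
  · rw [k3]
  · rw [k4, add_comm]
  · rw [k7]

theorem adj_map (S : Matrix (Fin 2) (Fin 2) E) (φ : E →ₐ[ℂ] F) :
    adj (S.map φ) = (adj S).map φ := by
  ext i j
  fin_cases i <;> fin_cases j <;> simp [adj]

end Exchange

theorem isExchange_lax₀ {q x y : ℂ} (hq : q ≠ 0) (hx : x ≠ 0) (hy : y ≠ 0) :
    IsExchange q (x / y) (lax₀ q x) (lax₀ q y) := by
  unfold IsExchange
  ext ⟨i, k⟩ ⟨j, l⟩ s t
  simp only [Matrix.mul_apply (M := rMat _ q _), Matrix.mul_apply (N := rMat _ q _),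
    Fintype.sum_prod_type, Fin.sum_univ_two, auxFst_mul_auxSnd_apply,
    auxSnd_mul_auxFst_apply]
  fin_cases i <;> fin_cases k <;> fin_cases j <;> fin_cases l <;>
    simp [rMat, lax₀, ← Algebra.commutes, ← Algebra.smul_def] <;>
    fin_cases s <;> fin_cases t <;> simp [sn] <;>
    first | (field_simp; ring1) | (left; field_simp)

theorem lax₀_mul_adj {q x : ℂ} (hq : q ≠ 0) (hx : x ≠ 0) :
    lax₀ q x * adj (lax₀ q (x / q)) = (sn (x * q) * sn (x / q)) • 1 := by
  ext i j s t
  fin_cases i <;> fin_cases j <;>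
    simp [lax₀, adj, Matrix.mul_apply, Fin.sum_univ_two, hq] <;>
    fin_cases s <;> fin_cases t <;> simp [sn] <;> field_simp <;> ring

/-! ### The monodromy matrix of a list of sites -/

/-- The product of the Lax operators of the sites in `l`. -/
def chain {N : ℕ} (q : ℂ) (η : Fin N → ℂ) (l : List (Fin N)) (x : ℂ) :
    Matrix (Fin 2) (Fin 2) (Op N) :=
  (l.map fun n => lax q n (x / η n)).prod

variable {N : ℕ} {q : ℂ} {η : Fin N → ℂ}

theorem monodromy_eq_chain (x : ℂ) :
    monodromy q η x = chain q η (List.finRange N).reverse x := by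
  rw [monodromy, chain, List.ofFn_eq_map, List.map_reverse]

theorem chain_nil (x : ℂ) : chain q η [] x = 1 := rfl

theorem chain_cons (n : Fin N) (l : List (Fin N)) (x : ℂ) :
    chain q η (n :: l) x = lax q n (x / η n) * chain q η l x := by
  simp [chain]

theorem commute_lax_chain {n : Fin N} {l : List (Fin N)} (h : n ∉ l) (x y : ℂ) (i j k m : Fin 2) :
    Commute (lax q n y i j) (chain q η l x k m) := by
  induction l generalizing k m with
  | nil =>
    rw [chain_nil, Matrix.one_apply]
    split_ifs
    · exact Commute.one_right _
    · exact Commute.zero_right _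
  | cons n' l ih =>
    rw [List.mem_cons, not_or] at h
    rw [chain_cons, Matrix.mul_apply]
    refine Commute.sum_right _ _ _ fun u _ => Commute.mul_right ?_ (ih h.2 _ _)
    rw [lax_eq_map, lax_eq_map]
    exact commute_siteHom h.1 _ _

theorem isExchange_chain (hq : q ≠ 0) (hη : ∀ n, η n ≠ 0) {x y : ℂ} (hx : x ≠ 0) (hy : y ≠ 0)
    {l : List (Fin N)} (hl : l.Nodup) :
    IsExchange q (x / y) (chain q η l x) (chain q η l y) := by
  induction l with
  | nil => exact IsExchange.one _ _
  | cons n l ih =>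
    rw [List.nodup_cons] at hl
    rw [chain_cons, chain_cons]
    refine IsExchange.mul ?_ (ih hl.2) (fun _ _ _ _ => (commute_lax_chain hl.1 _ _ _ _ _ _).symm)
      (fun _ _ _ _ => commute_lax_chain hl.1 _ _ _ _ _ _)
    have h := (isExchange_lax₀ hq (div_ne_zero hx (hη n)) (div_ne_zero hy (hη n))).map (siteHom n)
    rwa [div_div_div_cancel_right₀ (hη n), ← lax_eq_map, ← lax_eq_map] at h

theorem chain_mul_adj (hq : q ≠ 0) (hη : ∀ n, η n ≠ 0) {x : ℂ} (hx : x ≠ 0)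
    {l : List (Fin N)} (hl : l.Nodup) :
    chain q η l x * adj (chain q η l (x / q))
      = (l.map fun n => sn (x * q / η n) * sn (x / q / η n)).prod • 1 := by
  induction l with
  | nil =>
    rw [chain_nil, chain_nil, List.map_nil, List.prod_nil, one_smul, one_mul]
    ext1 i j
    fin_cases i <;> fin_cases j <;> simp [adj]
  | cons n l ih =>
    rw [List.nodup_cons] at hl
    rw [chain_cons, chain_cons, adj_mul fun _ _ _ _ => commute_lax_chain hl.1 _ _ _ _ _ _,
      mul_assoc, ← mul_assoc (chain q η l x), ih hl.2, smul_mul_assoc, one_mul, mul_smul_comm]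
    have h : lax q n (x / η n) * adj (lax q n (x / q / η n))
        = (sn (x * q / η n) * sn (x / q / η n)) • 1 := by
      have h0 := congrArg (fun M => M.map (siteHom n))
        (lax₀_mul_adj hq (div_ne_zero hx (hη n)))
      simp only [Matrix.map_mul] at h0
      rw [lax_eq_map, lax_eq_map, adj_map, div_right_comm x q, h0, div_mul_eq_mul_div]
      ext1 i j
      simp only [Matrix.map_apply, Matrix.smul_apply, map_smul, Matrix.one_apply,
        apply_ite (siteHom n), map_one, map_zero]
    rw [h, smul_smul, List.map_cons, List.prod_cons, mul_comm]

theorem prod_reverse_finRange (f : Fin N → ℂ) :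
    ((List.finRange N).reverse.map f).prod = ∏ n, f n := by
  rw [List.map_reverse, List.prod_reverse, ← List.ofFn_eq_map, List.prod_ofFn]

theorem monodromy_mul_adj (hq : q ≠ 0) (hη : ∀ n, η n ≠ 0) {x : ℂ} (hx : x ≠ 0) :
    monodromy q η x * adj (monodromy q η (x / q)) = (-(aFun q η x * dFun η (x / q))) • 1 := by
  rw [monodromy_eq_chain, monodromy_eq_chain,
    chain_mul_adj hq hη hx (List.nodup_reverse.2 (List.nodup_finRange N)), prod_reverse_finRange,
    Finset.prod_mul_distrib, aFun, dFun, neg_mul, neg_neg]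

theorem isExchange_monodromy (hq : q ≠ 0) (hη : ∀ n, η n ≠ 0) {x y : ℂ} (hx : x ≠ 0)
    (hy : y ≠ 0) : IsExchange q (x / y) (monodromy q η x) (monodromy q η y) := by
  rw [monodromy_eq_chain, monodromy_eq_chain]
  exact isExchange_chain hq hη hx hy (List.nodup_reverse.2 (List.nodup_finRange N))

/-- The quantum determinant relation. -/
theorem qdet_AD (hq : q ≠ 0) (hη : ∀ n, η n ≠ 0) {x : ℂ} (hx : x ≠ 0) :
    opA q η x * opD q η (x / q) - opB q η x * opC q η (x / q)
      = (-(aFun q η x * dFun η (x / q))) • (1 : Op N) := by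
  have h := congrFun (congrFun (monodromy_mul_adj hq hη hx) 0) 0
  simpa [adj, Matrix.mul_apply, Fin.sum_univ_two, ← sub_eq_add_neg, opA, opB, opC, opD] using h

theorem qdet_DA (hq : q ≠ 0) (hη : ∀ n, η n ≠ 0) {x : ℂ} (hx : x ≠ 0) :
    opD q η x * opA q η (x / q) - opC q η x * opB q η (x / q)
      = (-(aFun q η x * dFun η (x / q))) • (1 : Op N) := by
  have h := congrFun (congrFun (monodromy_mul_adj hq hη hx) 1) 1
  simpa [adj, Matrix.mul_apply, Fin.sum_univ_two, neg_add_eq_sub, opA, opB, opC, opD] using h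

theorem sn_inv (u : ℂ) : sn u⁻¹ = -sn u := by simp [sn]

theorem sn_eq_zero_iff {u : ℂ} (hu : u ≠ 0) : sn u = 0 ↔ u ^ 2 = 1 := by
  rw [sn, sub_eq_zero, sq, eq_comm, inv_eq_iff_eq_inv]
  exact ⟨fun h => by nth_rw 2 [h]; exact mul_inv_cancel₀ hu, eq_inv_of_mul_eq_one_left⟩

/-- The left representation needs this order of the factors. At spectral ratio `q⁻¹` both
coefficients in the exchange relation of `A` with `D` are `± sn q`, so it identifies this expression
with that of `qdet_DA`; `sn q` cancels because `q ^ 2 ≠ 1`. -/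
theorem qdet_AD' (hq : q ≠ 0) (hq1 : q ^ 2 ≠ 1) (hη : ∀ n, η n ≠ 0) {x : ℂ} (hx : x ≠ 0) :
    opA q η (x / q) * opD q η x - opC q η (x / q) * opB q η x
      = (-(aFun q η x * dFun η (x / q))) • (1 : Op N) := by
  rw [← qdet_DA hq hη hx]
  have h := (isExchange_monodromy hq hη (div_ne_zero hx hq) hx).entries.2.2.2.2.2.2
  rw [div_div_cancel_left' hx, sn_inv] at h
  have h' : sn q • (opA q η (x / q) * opD q η x - opC q η (x / q) * opB q η x
      - (opD q η x * opA q η (x / q) - opC q η x * opB q η (x / q))) = 0 := by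
    simp only [opA, opB, opC, opD, smul_sub]
    simp only [neg_smul] at h
    rw [← sub_eq_zero] at h
    rw [← neg_eq_zero, ← h]
    abel
  exact sub_eq_zero.1 ((smul_eq_zero.1 h').resolve_left fun h0 => hq1 ((sn_eq_zero_iff hq).1 h0))

/-! ### The reference state -/

theorem siteOp_mulVec_refState (n : Fin N) {m : Matrix (Fin 2) (Fin 2) ℂ} {c : ℂ}
    (h0 : m 0 0 = c) (h1 : m 1 0 = 0) : siteOp n m *ᵥ refState N = c • refState N := by
  ext s
  rw [refState, Matrix.mulVec_single_one, Matrix.col_apply, Pi.smul_apply, siteOp_eq_mul_prod]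
  have hm : m (s n) 0 = c * (1 : Matrix (Fin 2) (Fin 2) ℂ) (s n) 0 := by
    rcases Fin.exists_fin_two.1 ⟨s n, rfl⟩ with h | h <;> rw [h] <;> simp [h0, h1]
  rw [hm, mul_assoc, Finset.mul_prod_erase _ (fun k => (1 : Matrix (Fin 2) (Fin 2) ℂ) (s k) 0)
    (Finset.mem_univ n), smul_eq_mul]
  congr 1
  simp only [Matrix.one_apply, Finset.prod_ite_zero, Pi.single_apply, funext_iff]
  simp

theorem refState_vecMul_siteOp (n : Fin N) {m : Matrix (Fin 2) (Fin 2) ℂ} {c : ℂ}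
    (h0 : m 0 0 = c) (h1 : m 0 1 = 0) : refState N ᵥ* siteOp n m = c • refState N := by
  rw [← Matrix.mulVec_transpose, siteOp_transpose]
  exact siteOp_mulVec_refState n h0 h1

/-- The two claims must be proved together: the upper left entry of a product involves the lower
left entry of the tail, which kills the reference vector. -/
theorem chain_mulVec_refState (l : List (Fin N)) (x : ℂ) :
    chain q η l x 0 0 *ᵥ refState N = (l.map fun n => sn (x * q / η n)).prod • refState N ∧
      chain q η l x 1 0 *ᵥ refState N = 0 := by
  induction l with
  | nil => simp [chain_nil]
  | cons n l ih =>
    have hA : lax q n (x / η n) 0 0 *ᵥ refState N = sn (x * q / η n) • refState N := by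
      rw [lax_eq_map]
      exact siteOp_mulVec_refState n (by simp [lax₀, div_mul_eq_mul_div]) (by simp [lax₀])
    have hC : lax q n (x / η n) 1 0 *ᵥ refState N = 0 := by
      rw [lax_eq_map, ← zero_smul ℂ (refState N)]
      exact siteOp_mulVec_refState n (by simp [lax₀]) (by simp [lax₀])
    simp only [chain_cons, Matrix.mul_apply, Fin.sum_univ_two, Matrix.add_mulVec,
      ← Matrix.mulVec_mulVec, ih.1, ih.2, Matrix.mulVec_smul, hA, hC, smul_zero,
      Matrix.mulVec_zero, add_zero, smul_smul, List.map_cons, List.prod_cons, and_true]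
    rw [mul_comm]

/-- Here the off-diagonal factor of the first site meets the covector first and kills it, so nothing
is needed about the tail's other entries. -/
theorem refState_vecMul_chain (l : List (Fin N)) (x : ℂ) :
    refState N ᵥ* chain q η l x 0 0 = (l.map fun n => sn (x * q / η n)).prod • refState N := by
  induction l with
  | nil => simp [chain_nil]
  | cons n l ih =>
    have hA : refState N ᵥ* lax q n (x / η n) 0 0 = sn (x * q / η n) • refState N := by
      rw [lax_eq_map]
      exact refState_vecMul_siteOp n (by simp [lax₀, div_mul_eq_mul_div]) (by simp [lax₀])
    have hB : refState N ᵥ* lax q n (x / η n) 0 1 = 0 := by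
      rw [lax_eq_map, ← zero_smul ℂ (refState N)]
      exact refState_vecMul_siteOp n (by simp [lax₀]) (by simp [lax₀])
    simp only [chain_cons, Matrix.mul_apply, Fin.sum_univ_two, Matrix.vecMul_add,
      ← Matrix.vecMul_vecMul, ih, Matrix.smul_vecMul, hA, hB,
      Matrix.zero_vecMul, add_zero, smul_smul, List.map_cons, List.prod_cons]

theorem opA_mulVec_refState (x : ℂ) :
    opA q η x *ᵥ refState N = (∏ n, sn (x * q / η n)) • refState N := by
  rw [opA, monodromy_eq_chain, (chain_mulVec_refState _ x).1, prod_reverse_finRange]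

theorem refState_vecMul_opA (x : ℂ) :
    refState N ᵥ* opA q η x = (∏ n, sn (x * q / η n)) • refState N := by
  rw [opA, monodromy_eq_chain, refState_vecMul_chain, prod_reverse_finRange]

/-! ### Laurent polynomials -/

/-- `f(x) = x⁻ⁿ p(x²)` with `deg p ≤ n`. -/
def IsEvenLaurent (n : ℕ) (f : ℂ → ℂ) : Prop :=
  ∃ p : Polynomial ℂ, p.degree ≤ n ∧ ∀ x, x ≠ 0 → x ^ n * f x = p.eval (x ^ 2)

/-- `f(x) = x¹⁻ⁿ p(x²)` with `deg p < n`. -/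
def IsOddLaurent (n : ℕ) (f : ℂ → ℂ) : Prop :=
  ∃ p : Polynomial ℂ, p.degree < n ∧ ∀ x, x ≠ 0 → x ^ n * f x = x * p.eval (x ^ 2)

section Laurent

variable {m n : ℕ} {f g : ℂ → ℂ}

theorem IsEvenLaurent.add (hf : IsEvenLaurent n f) (hg : IsEvenLaurent n g) :
    IsEvenLaurent n (fun x => f x + g x) := by
  obtain ⟨p, hp, hpf⟩ := hf
  obtain ⟨r, hr, hrg⟩ := hg
  exact ⟨p + r, (Polynomial.degree_add_le _ _).trans (max_le hp hr), fun x hx => by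
    rw [mul_add, hpf x hx, hrg x hx, Polynomial.eval_add]⟩

theorem IsOddLaurent.add (hf : IsOddLaurent n f) (hg : IsOddLaurent n g) :
    IsOddLaurent n (fun x => f x + g x) := by
  obtain ⟨p, hp, hpf⟩ := hf
  obtain ⟨r, hr, hrg⟩ := hg
  exact ⟨p + r, (Polynomial.degree_add_le _ _).trans_lt (max_lt hp hr), fun x hx => by
    rw [mul_add, hpf x hx, hrg x hx, Polynomial.eval_add, mul_add]⟩

theorem IsEvenLaurent.mul (hf : IsEvenLaurent m f) (hg : IsEvenLaurent n g) :
    IsEvenLaurent (m + n) (fun x => f x * g x) := by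
  obtain ⟨p, hp, hpf⟩ := hf
  obtain ⟨r, hr, hrg⟩ := hg
  refine ⟨p * r, ?_, fun x hx => ?_⟩
  · rw [Polynomial.degree_mul, Nat.cast_add]
    exact add_le_add hp hr
  · rw [Polynomial.eval_mul, ← hpf x hx, ← hrg x hx]
    ring

theorem IsEvenLaurent.mul_odd (hf : IsEvenLaurent m f) (hg : IsOddLaurent n g) :
    IsOddLaurent (m + n) (fun x => f x * g x) := by
  obtain ⟨p, hp, hpf⟩ := hf
  obtain ⟨r, hr, hrg⟩ := hg
  refine ⟨p * r, ?_, fun x hx => ?_⟩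
  · rw [← Polynomial.mem_degreeLT] at hr ⊢
    by_cases h : p * r = 0
    · rw [h]; exact zero_mem _
    · obtain ⟨hp0, hr0⟩ := mul_ne_zero_iff.1 h
      rw [Polynomial.mem_degreeLT, Polynomial.degree_eq_natDegree hr0, Nat.cast_lt] at hr
      rw [Polynomial.degree_eq_natDegree hp0, Nat.cast_le] at hp
      rw [Polynomial.mem_degreeLT, Polynomial.degree_eq_natDegree h,
        Polynomial.natDegree_mul hp0 hr0, Nat.cast_lt]
      omega
  · rw [Polynomial.eval_mul]
    linear_combination (x ^ n * g x) * hpf x hx + Polynomial.eval (x ^ 2) p * hrg x hx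

theorem IsOddLaurent.mul_even (hf : IsOddLaurent m f) (hg : IsEvenLaurent n g) :
    IsOddLaurent (m + n) (fun x => f x * g x) := by
  rw [add_comm]
  simpa only [mul_comm] using hg.mul_odd hf

theorem IsOddLaurent.mul (hf : IsOddLaurent m f) (hg : IsOddLaurent n g) :
    IsEvenLaurent (m + n) (fun x => f x * g x) := by
  obtain ⟨p, hp, hpf⟩ := hf
  obtain ⟨r, hr, hrg⟩ := hg
  refine ⟨Polynomial.X * (p * r), ?_, fun x hx => ?_⟩
  · by_cases h : p * r = 0
    · simp [h]
    · obtain ⟨hp0, hr0⟩ := mul_ne_zero_iff.1 h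
      rw [Polynomial.degree_eq_natDegree hr0, Nat.cast_lt] at hr
      rw [Polynomial.degree_eq_natDegree hp0, Nat.cast_lt] at hp
      rw [Polynomial.degree_eq_natDegree (mul_ne_zero Polynomial.X_ne_zero h),
        Polynomial.natDegree_X_mul h, Polynomial.natDegree_mul hp0 hr0, Nat.cast_le]
      omega
  · rw [Polynomial.eval_mul, Polynomial.eval_mul, Polynomial.eval_X]
    linear_combination (x ^ n * g x) * hpf x hx + (x * Polynomial.eval (x ^ 2) p) * hrg x hx

theorem isOddLaurent_zero : IsOddLaurent n (fun _ => 0) :=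
  ⟨0, by simp, by simp⟩

theorem isOddLaurent_const (c : ℂ) : IsOddLaurent 1 (fun _ => c) :=
  ⟨Polynomial.C c, Polynomial.degree_C_le.trans_lt (by norm_num), by simp⟩

theorem isEvenLaurent_sn {c : ℂ} (hc : c ≠ 0) : IsEvenLaurent 1 (fun x => sn (x * c)) := by
  refine ⟨Polynomial.C c * Polynomial.X + Polynomial.C (-c⁻¹),
    by exact_mod_cast Polynomial.degree_linear_le, fun x hx => ?_⟩
  simp [sn]
  field_simp
  ring

theorem isEvenLaurent_sum {ι : Type*} (s : Finset ι) {F : ι → ℂ → ℂ}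
    (h : ∀ i ∈ s, IsEvenLaurent n (F i)) : IsEvenLaurent n (fun x => ∑ i ∈ s, F i x) := by
  classical
  induction s using Finset.induction_on with
  | empty => exact ⟨0, by simp, by simp⟩
  | insert a s ha ih =>
    simp only [Finset.sum_insert ha]
    exact (h a (Finset.mem_insert_self a s)).add (ih fun i hi => h i (Finset.mem_insert_of_mem hi))

theorem isOddLaurent_sum {ι : Type*} (s : Finset ι) {F : ι → ℂ → ℂ}
    (h : ∀ i ∈ s, IsOddLaurent n (F i)) : IsOddLaurent n (fun x => ∑ i ∈ s, F i x) := by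
  classical
  induction s using Finset.induction_on with
  | empty => simpa using isOddLaurent_zero
  | insert a s ha ih =>
    simp only [Finset.sum_insert ha]
    exact (h a (Finset.mem_insert_self a s)).add (ih fun i hi => h i (Finset.mem_insert_of_mem hi))

theorem isEvenLaurent_prod {ι : Type*} (s : Finset ι) {c : ι → ℂ} (h : ∀ i ∈ s, c i ≠ 0) :
    IsEvenLaurent s.card (fun x => ∏ i ∈ s, sn (x * c i)) := by
  classical
  induction s using Finset.induction_on with
  | empty => exact ⟨1, by simp, by simp⟩
  | insert a s ha ih =>
    simp only [Finset.prod_insert ha, Finset.card_insert_of_notMem ha, add_comm _ 1]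
    exact (isEvenLaurent_sn (h a (Finset.mem_insert_self a s))).mul
      (ih fun i hi => h i (Finset.mem_insert_of_mem hi))

theorem IsEvenLaurent.continuousOn (hf : IsEvenLaurent n f) : ContinuousOn f {0}ᶜ := by
  obtain ⟨p, -, hp⟩ := hf
  have h : ContinuousOn (fun x : ℂ => (x ^ n)⁻¹ * p.eval (x ^ 2)) {0}ᶜ := by
    refine ContinuousOn.mul (ContinuousOn.inv₀ (by fun_prop) fun x hx => pow_ne_zero _ hx) ?_
    exact (p.continuous.comp (continuous_pow 2)).continuousOn
  refine h.congr fun x hx => ?_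
  simp only
  rw [← hp x hx, inv_mul_cancel_left₀ (pow_ne_zero _ hx)]

end Laurent

/-- The degrees of the entries of the monodromy matrix in the spectral parameter. -/
theorem isLaurent_chain (hq : q ≠ 0) (hη : ∀ n, η n ≠ 0) (l : List (Fin N)) (s t : Conf N) :
    IsEvenLaurent l.length (fun x => chain q η l x 0 0 s t) ∧
    IsOddLaurent l.length (fun x => chain q η l x 0 1 s t) ∧
    IsOddLaurent l.length (fun x => chain q η l x 1 0 s t) ∧
    IsEvenLaurent l.length (fun x => chain q η l x 1 1 s t) := by
  induction l generalizing s t with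
  | nil =>
    simp only [chain_nil, List.length_nil]
    refine ⟨⟨Polynomial.C ((1 : Op N) s t), Polynomial.degree_C_le, by simp⟩, ?_, ?_,
      ⟨Polynomial.C ((1 : Op N) s t), Polynomial.degree_C_le, by simp⟩⟩ <;>
    exact isOddLaurent_zero
  | cons n l ih =>
    have h0 : (η n)⁻¹ ≠ 0 := inv_ne_zero (hη n)
    have h1 : q * (η n)⁻¹ ≠ 0 := mul_ne_zero hq h0
    have hconst : ∀ c : ℂ, IsEvenLaurent 0 (fun _ => c) := fun c =>
      ⟨Polynomial.C c, Polynomial.degree_C_le, by simp⟩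
    have hd : ∀ (i : Fin 2) (s t : Conf N),
        IsEvenLaurent 1 (fun x => lax q n (x / η n) i i s t) := by
      intro i s t
      have key : ∀ c d : ℂ, c ≠ 0 → d ≠ 0 → IsEvenLaurent 1
          (fun x => siteOp n !![sn (x * c), 0; 0, sn (x * d)] s t) := by
        intro c d hc hd
        simp only [siteOp_eq_mul_prod]
        refine IsEvenLaurent.mul (m := 1) (n := 0) ?_ (hconst _)
        rcases Fin.exists_fin_two.1 ⟨s n, rfl⟩ with h | h <;>
        rcases Fin.exists_fin_two.1 ⟨t n, rfl⟩ with h' | h' <;> rw [h, h']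
        · exact isEvenLaurent_sn hc
        · exact ⟨0, by simp, by simp⟩
        · exact ⟨0, by simp, by simp⟩
        · exact isEvenLaurent_sn hd
      rcases Fin.exists_fin_two.1 ⟨i, rfl⟩ with rfl | rfl
      · convert key _ _ h1 h0 using 2 with x
        simp only [lax_eq_map, Matrix.map_apply, siteHom_apply]
        simp [lax₀, div_eq_mul_inv, mul_assoc, mul_comm q]
      · convert key _ _ h0 h1 using 2 with x
        simp only [lax_eq_map, Matrix.map_apply, siteHom_apply]
        simp [lax₀, div_eq_mul_inv, mul_assoc, mul_comm q]
    have ho : ∀ (i j : Fin 2) (s t : Conf N), i ≠ j →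
        IsOddLaurent 1 (fun x => lax q n (x / η n) i j s t) := by
      intro i j s t hij
      rcases Fin.exists_fin_two.1 ⟨i, rfl⟩ with rfl | rfl <;>
      rcases Fin.exists_fin_two.1 ⟨j, rfl⟩ with rfl | rfl
      · exact absurd rfl hij
      · simpa [lax] using isOddLaurent_const _
      · simpa [lax] using isOddLaurent_const _
      · exact absurd rfl hij
    simp only [chain_cons, Matrix.mul_apply, Fin.sum_univ_two, Matrix.add_apply, List.length_cons,
      add_comm l.length 1]
    exact ⟨(isEvenLaurent_sum _ fun u _ => (hd 0 s u).mul (ih u t).1).add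
        (isEvenLaurent_sum _ fun u _ => (ho 0 1 s u (by decide)).mul (ih u t).2.2.1),
      (isOddLaurent_sum _ fun u _ => (hd 0 s u).mul_odd (ih u t).2.1).add
        (isOddLaurent_sum _ fun u _ => (ho 0 1 s u (by decide)).mul_even (ih u t).2.2.2),
      (isOddLaurent_sum _ fun u _ => (ho 1 0 s u (by decide)).mul_even (ih u t).1).add
        (isOddLaurent_sum _ fun u _ => (hd 1 s u).mul_odd (ih u t).2.2.1),
      (isEvenLaurent_sum _ fun u _ => (ho 1 0 s u (by decide)).mul (ih u t).2.1).add
        (isEvenLaurent_sum _ fun u _ => (hd 1 s u).mul (ih u t).2.2.2)⟩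

theorem isLaurent_monodromy (hq : q ≠ 0) (hη : ∀ n, η n ≠ 0) (s t : Conf N) :
    IsEvenLaurent N (fun x => opA q η x s t) ∧ IsOddLaurent N (fun x => opB q η x s t) ∧
    IsOddLaurent N (fun x => opC q η x s t) ∧ IsEvenLaurent N (fun x => opD q η x s t) := by
  have h := isLaurent_chain (q := q) hq hη (List.finRange N).reverse s t
  simp only [List.length_reverse, List.length_finRange, ← monodromy_eq_chain] at h
  exact h

/-- Lagrange interpolation. -/
theorem IsOddLaurent.interpolate {f : ℂ → ℂ} (hf : IsOddLaurent N f) {ζ : Fin N → ℂ}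
    (hζ : ∀ a, ζ a ≠ 0) (hinj : ∀ a b, a ≠ b → ζ a ^ 2 ≠ ζ b ^ 2) {x : ℂ} (hx : x ≠ 0) :
    f x = ∑ a, (∏ b ∈ Finset.univ.erase a, sn (x / ζ b) / sn (ζ a / ζ b)) * f (ζ a) := by
  set g : ℂ → ℂ := fun x =>
    ∑ a, (∏ b ∈ Finset.univ.erase a, sn (x / ζ b) / sn (ζ a / ζ b)) * f (ζ a) with hg
  -- Each summand has `N - 1` factors of even type and one constant, which counts as odd type of
  -- order 1.
  have hgodd : IsOddLaurent N g := by
    refine isOddLaurent_sum _ fun a _ => ?_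
    have h1 := isEvenLaurent_prod (Finset.univ.erase a) (c := fun b => (ζ b)⁻¹)
      fun b _ => inv_ne_zero (hζ b)
    have h2 := h1.mul_odd (isOddLaurent_const
      ((∏ b ∈ Finset.univ.erase a, sn (ζ a / ζ b))⁻¹ * f (ζ a)))
    rw [Finset.card_erase_of_mem (Finset.mem_univ a), Finset.card_univ, Fintype.card_fin,
      Nat.sub_add_cancel a.pos] at h2
    simpa only [Finset.prod_mul_distrib, Finset.prod_inv_distrib, div_eq_mul_inv, mul_assoc]
      using h2
  have hgval : ∀ c, g (ζ c) = f (ζ c) := by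
    intro c
    rw [hg]
    simp only
    rw [Finset.sum_eq_single c]
    · rw [Finset.prod_eq_one, one_mul]
      intro b hb
      refine div_self fun h => ?_
      rw [sn_eq_zero_iff (div_ne_zero (hζ c) (hζ b)), div_pow,
        div_eq_one_iff_eq (pow_ne_zero _ (hζ b))] at h
      exact hinj c b (Finset.ne_of_mem_erase hb).symm h
    · intro a _ hac
      rw [Finset.prod_eq_zero (Finset.mem_erase.2 ⟨hac.symm, Finset.mem_univ c⟩), zero_mul]
      simp [sn, hζ c]
    · simp
  obtain ⟨p, hp, hpf⟩ := hf
  obtain ⟨r, hr, hrg⟩ := hgodd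
  -- Two polynomials of degree below `N` that agree at the `N` distinct points `ζ a ^ 2`.
  have hpr : p = r := by
    refine Polynomial.eq_of_degrees_lt_of_eval_index_eq (s := Finset.univ)
      (v := fun a => ζ a ^ 2) (fun a _ b _ h => ?_) (by simpa using hp) (by simpa using hr)
      fun a _ => ?_
    · by_contra hab
      exact hinj a b hab h
    · refine mul_left_cancel₀ (hζ a) ?_
      rw [← hpf _ (hζ a), ← hrg _ (hζ a), hgval]
  refine mul_left_cancel₀ (pow_ne_zero N hx) ?_
  rw [hpf x hx, hpr, ← hrg x hx]

/-! ### Eigenvalue functions -/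

/-- The function with the zeros `± ζ n`. -/
def zeroProd {N : ℕ} (ζ : Fin N → ℂ) (x : ℂ) : ℂ := ∏ n, sn (x / ζ n)

/-- The zeros `ηₙ q^(hₙ - 1)` of `aEig q η h`. -/
def node {N : ℕ} (q : ℂ) (η : Fin N → ℂ) (h : Fin N → Fin 2) (n : Fin N) : ℂ :=
  η n * q ^ (hInt h n - 1)

theorem div_node (hq : q ≠ 0) (h : Fin N → Fin 2) (n : Fin N) (x : ℂ) :
    x / node q η h n = x * q ^ (1 - hInt h n) / η n := by
  rw [node, ← neg_sub, zpow_neg]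
  have := zpow_ne_zero (hInt h n - 1) hq
  field_simp

theorem aEig_eq_zeroProd (hq : q ≠ 0) (h : Fin N → Fin 2) (x : ℂ) :
    aEig q η h x = zeroProd (node q η h) x := by
  simp only [aEig, zeroProd, div_node hq]

theorem interp_eq (hq : q ≠ 0) (h : Fin N → Fin 2) (a : Fin N) (x : ℂ) :
    interp q η h a x = ∏ b ∈ Finset.univ.erase a,
      sn (x / node q η h b) / sn (node q η h a / node q η h b) := by
  refine Finset.prod_congr rfl fun b _ => ?_
  rw [div_node hq, div_node hq, node, mul_assoc, ← zpow_add₀ hq]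
  congr 5
  ring

theorem node_ne_zero (hq : q ≠ 0) (hη : ∀ n, η n ≠ 0) (h : Fin N → Fin 2) (n : Fin N) :
    node q η h n ≠ 0 :=
  mul_ne_zero (hη n) (zpow_ne_zero _ hq)

theorem node_of_eq_zero {h : Fin N → Fin 2} {a : Fin N} (ha : h a = 0) :
    node q η h a = η a / q := by
  simp [node, hInt, ha, div_eq_mul_inv]

theorem node_of_eq_one {h : Fin N → Fin 2} {a : Fin N} (ha : h a = 1) : node q η h a = η a := by
  simp [node, hInt, ha]

theorem node_update (h : Fin N → Fin 2) (a : Fin N) (i : Fin 2) :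
    node q η (Function.update h a i)
      = Function.update (node q η h) a (η a * q ^ (((i : ℕ) : ℤ) - 1)) := by
  ext n
  by_cases hn : n = a
  · subst hn; simp [node, hInt]
  · simp [node, hInt, hn]

theorem isEvenLaurent_zeroProd {ζ : Fin N → ℂ} (hζ : ∀ n, ζ n ≠ 0) :
    IsEvenLaurent N (zeroProd ζ) := by
  have h := isEvenLaurent_prod Finset.univ (c := fun n => (ζ n)⁻¹) fun n _ => inv_ne_zero (hζ n)
  rwa [Finset.card_univ, Fintype.card_fin] at h

theorem zeroProd_self {ζ : Fin N → ℂ} (hζ : ∀ n, ζ n ≠ 0) (a : Fin N) : zeroProd ζ (ζ a) = 0 :=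
  Finset.prod_eq_zero (Finset.mem_univ a) (by simp [sn, hζ a])

theorem zeroProd_eq_mul (ζ : Fin N → ℂ) (a : Fin N) (x : ℂ) :
    zeroProd ζ x = sn (x / ζ a) * ∏ n ∈ Finset.univ.erase a, sn (x / ζ n) :=
  (Finset.mul_prod_erase _ _ (Finset.mem_univ a)).symm

theorem zeroProd_update (ζ : Fin N → ℂ) (a : Fin N) (z x : ℂ) :
    zeroProd (Function.update ζ a z) x
      = sn (x / z) * ∏ n ∈ Finset.univ.erase a, sn (x / ζ n) := by
  rw [zeroProd_eq_mul _ a, Function.update_self]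
  congr 1
  exact Finset.prod_congr rfl fun n hn => by
    rw [Function.update_of_ne (Finset.ne_of_mem_erase hn)]

theorem sn_div_eq_zero_iff {x y : ℂ} (hx : x ≠ 0) (hy : y ≠ 0) :
    sn (x / y) = 0 ↔ x ^ 2 = y ^ 2 := by
  rw [sn_eq_zero_iff (div_ne_zero hx hy), div_pow, div_eq_one_iff_eq (pow_ne_zero _ hy)]

theorem exists_ne_zero_sq_notMem (s : Finset ℂ) : ∃ x : ℂ, x ≠ 0 ∧ x ^ 2 ∉ s := by
  obtain ⟨t, ht⟩ := Infinite.exists_notMem_finset (insert 0 s)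
  rw [Finset.mem_insert, not_or] at ht
  obtain ⟨x, rfl⟩ := IsAlgClosed.exists_pow_nat_eq t zero_lt_two
  exact ⟨x, fun h => ht.1 (by simp [h]), ht.2⟩

/-- If two functions `zeroProd` agree and each zero of the first but the `a`-th can only meet an
equal zero of the second at the same index, then the `a`-th zeros agree too. -/
theorem eq_of_zeroProd_eq {ζ ξ : Fin N → ℂ} (hζ : ∀ n, ζ n ≠ 0) (hξ : ∀ n, ξ n ≠ 0) (a : Fin N)
    (hsep : ∀ b, b ≠ a → ∀ c, ζ b ^ 2 = ξ c ^ 2 → ζ b = ξ b)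
    (h : ∀ x, x ≠ 0 → zeroProd ζ x = zeroProd ξ x) : ζ a = ξ a := by
  have hb : ∀ b, b ≠ a → ζ b = ξ b := by
    intro b hba
    have h0 := h (ζ b) (hζ b)
    rw [zeroProd_self hζ, eq_comm, zeroProd, Finset.prod_eq_zero_iff] at h0
    obtain ⟨c, -, hc⟩ := h0
    exact hsep b hba c ((sn_div_eq_zero_iff (hζ b) (hξ c)).1 hc)
  -- Excluding `x ^ 2 = ζ n ^ 2` keeps the common factors nonzero. Excluding `x ^ 2 = -ζ a * ξ a`
  -- removes the only other way in which the two remaining factors could agree. This determines the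
  -- zero itself and not only its square.
  obtain ⟨x, hx, hxs⟩ := exists_ne_zero_sq_notMem
    (insert (-(ζ a * ξ a)) (Finset.univ.image fun n => ζ n ^ 2))
  rw [Finset.mem_insert, not_or] at hxs
  have h1 := h x hx
  have hprod : ∏ n ∈ Finset.univ.erase a, sn (x / ξ n) = ∏ n ∈ Finset.univ.erase a, sn (x / ζ n) :=
    Finset.prod_congr rfl fun n hn => by rw [hb n (Finset.ne_of_mem_erase hn)]
  rw [zeroProd_eq_mul ζ a, zeroProd_eq_mul ξ a, hprod] at h1
  have h2 : ∏ n ∈ Finset.univ.erase a, sn (x / ζ n) ≠ 0 := by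
    refine Finset.prod_ne_zero_iff.2 fun n _ hn => hxs.2 ?_
    rw [(sn_div_eq_zero_iff hx (hζ n)).1 hn]
    exact Finset.mem_image_of_mem _ (Finset.mem_univ n)
  have h3 := mul_right_cancel₀ h2 h1
  have h4 : (x ^ 2 + ζ a * ξ a) * (ζ a - ξ a) = 0 := by
    have h5 := hζ a
    have h6 := hξ a
    simp only [sn] at h3
    field_simp at h3
    linear_combination -h3
  rcases mul_eq_zero.1 h4 with h5 | h5
  · exact absurd (eq_neg_of_add_eq_zero_left h5) hxs.1
  · exact sub_eq_zero.1 h5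

/-! ### Generic inhomogeneities -/

/-- The genericity condition on the inhomogeneities, in terms of squares. -/
def IsGeneric {N : ℕ} (q : ℂ) (η : Fin N → ℂ) : Prop :=
  ∀ a b : Fin N, a ≠ b → ∀ j ∈ ({-1, 0, 1} : Set ℤ), η a ^ 2 ≠ (q ^ j * η b) ^ 2

theorem isGeneric_of_lt (hq : q ≠ 0)
    (hSOV : ∀ a b : Fin N, a < b → ∀ j ∈ ({-1, 0, 1} : Set ℤ),
      η a ≠ q ^ j * η b ∧ η a ≠ -(q ^ j * η b)) : IsGeneric q η := by
  have key : ∀ a b : Fin N, a < b → ∀ j ∈ ({-1, 0, 1} : Set ℤ), η a ^ 2 ≠ (q ^ j * η b) ^ 2 := by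
    intro a b hab j hj h
    rcases sq_eq_sq_iff_eq_or_eq_neg.1 h with h | h
    · exact (hSOV a b hab j hj).1 h
    · exact (hSOV a b hab j hj).2 h
  intro a b hab j hj
  rcases lt_or_gt_of_ne hab with h | h
  · exact key a b h j hj
  · intro h'
    refine key b a h (-j) ?_ ?_
    · simp only [Set.mem_insert_iff, Set.mem_singleton_iff] at hj ⊢
      omega
    · rw [mul_pow, h', ← mul_pow, ← mul_assoc, ← zpow_add₀ hq]
      simp

/-- Two nodes at different sites could meet only through a relation with exponent `k_c - h_b`, which
lies in `{-1, 0, 1}` and is excluded. At a single site distinct labels would force `q ^ 2 = 1`. -/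
theorem IsGeneric.eq_of_node_sq_eq (hg : IsGeneric q η) (hq : q ≠ 0) (hq1 : q ^ 2 ≠ 1)
    (hη : ∀ n, η n ≠ 0) {h k : Fin N → Fin 2} {b c : Fin N}
    (e : node q η h b ^ 2 = node q η k c ^ 2) : b = c ∧ h b = k c := by
  have e1 : η b ^ 2 = (q ^ (hInt k c - hInt h b) * η c) ^ 2 := by
    have h1 : (q ^ (hInt h b - 1)) ^ 2 ≠ 0 := pow_ne_zero _ (zpow_ne_zero _ hq)
    have h2 : q ^ (hInt k c - 1) = q ^ (hInt k c - hInt h b) * q ^ (hInt h b - 1) := by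
      rw [← zpow_add₀ hq]; congr 1; ring
    simp only [node] at e
    rw [h2, mul_pow] at e
    refine mul_right_cancel₀ h1 (e.trans ?_)
    ring
  have hbc : b = c := by
    by_contra hbc
    refine hg b c hbc _ ?_ e1
    have := (h b).isLt
    have := (k c).isLt
    simp only [Set.mem_insert_iff, Set.mem_singleton_iff, hInt]
    omega
  refine ⟨hbc, ?_⟩
  subst hbc
  have e2 : (q ^ (hInt k b - hInt h b)) ^ 2 = 1 := by
    rw [mul_pow] at e1
    exact mul_right_cancel₀ (pow_ne_zero 2 (hη b)) (by rw [← e1, one_mul])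
  rcases Fin.exists_fin_two.1 ⟨h b, rfl⟩ with h1 | h1 <;>
  rcases Fin.exists_fin_two.1 ⟨k b, rfl⟩ with h2 | h2 <;> rw [h1, h2]
  · exact absurd (by simpa [hInt, h1, h2] using e2) hq1
  · refine absurd ?_ hq1
    simpa [hInt, h1, h2] using e2

/-- An eigenvalue function with one node moved to `z` is that of some `k` only if `z` is a node. -/
theorem IsGeneric.eq_node (hg : IsGeneric q η) (hq : q ≠ 0) (hq1 : q ^ 2 ≠ 1)
    (hη : ∀ n, η n ≠ 0) {h k : Fin N → Fin 2} {a : Fin N} {z : ℂ} (hz : z ≠ 0)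
    (e : ∀ x, x ≠ 0 → zeroProd (Function.update (node q η h) a z) x = aEig q η k x) :
    z = node q η k a := by
  simp only [aEig_eq_zeroProd hq] at e
  have h0 : ∀ n, Function.update (node q η h) a z n ≠ 0 := by
    intro n
    by_cases hn : n = a
    · subst hn; simpa using hz
    · simpa [hn] using node_ne_zero hq hη h n
  have h1 := eq_of_zeroProd_eq h0 (node_ne_zero hq hη k) a ?_ e
  · simpa using h1
  · intro b hb c hc
    rw [Function.update_of_ne hb] at hc ⊢
    obtain ⟨rfl, h2⟩ := hg.eq_of_node_sq_eq hq hq1 hη hc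
    simp [node, hInt, h2]

theorem IsGeneric.aEig_injective (hg : IsGeneric q η) (hq : q ≠ 0) (hq1 : q ^ 2 ≠ 1)
    (hη : ∀ n, η n ≠ 0) {h k : Fin N → Fin 2} (hk : h ≠ k) :
    ∃ x : ℂ, x ≠ 0 ∧ aEig q η h x ≠ aEig q η k x := by
  obtain ⟨a, ha⟩ := Function.ne_iff.1 hk
  by_contra! e
  refine ha (hg.eq_of_node_sq_eq hq hq1 hη (h := h) (k := k) (b := a) (c := a) ?_).2
  -- A node moved to itself changes nothing, so `eq_node` applies to the eigenvalue function of `h`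
  -- itself.
  rw [hg.eq_node hq hq1 hη (h := h) (k := k) (node_ne_zero hq hη h a) fun x hx => ?_]
  rw [Function.update_eq_self, ← aEig_eq_zeroProd hq, e x hx]

theorem IsEvenLaurent.finite_eq {n : ℕ} {f g : ℂ → ℂ} (hf : IsEvenLaurent n f)
    (hg : IsEvenLaurent n g) (hne : ∃ x, x ≠ 0 ∧ f x ≠ g x) :
    ∃ s : Finset ℂ, ∀ x, x ≠ 0 → f x = g x → x ^ 2 ∈ s := by
  obtain ⟨p, -, hp⟩ := hf
  obtain ⟨r, -, hr⟩ := hg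
  obtain ⟨y, hy, hfg⟩ := hne
  have hpr : p - r ≠ 0 := by
    intro h
    rw [sub_eq_zero] at h
    refine hfg (mul_left_cancel₀ (pow_ne_zero n hy) ?_)
    rw [hp y hy, hr y hy, h]
  refine ⟨(p - r).roots.toFinset, fun x hx h => ?_⟩
  rw [Multiset.mem_toFinset, Polynomial.mem_roots hpr, Polynomial.IsRoot, Polynomial.eval_sub,
    ← hp x hx, ← hr x hx, h, sub_self]

theorem isEvenLaurent_aEig (hq : q ≠ 0) (hη : ∀ n, η n ≠ 0) (h : Fin N → Fin 2) :
    IsEvenLaurent N (aEig q η h) := by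
  rw [funext (aEig_eq_zeroProd hq h)]
  exact isEvenLaurent_zeroProd (node_ne_zero hq hη h)

/-- At a generic point the eigenvalues are pairwise distinct. -/
theorem IsGeneric.exists_injective_aEig (hg : IsGeneric q η) (hq : q ≠ 0) (hq1 : q ^ 2 ≠ 1)
    (hη : ∀ n, η n ≠ 0) : ∃ x : ℂ, x ≠ 0 ∧ Function.Injective fun h => aEig q η h x := by
  have key : ∀ p : (Fin N → Fin 2) × (Fin N → Fin 2), ∃ s : Finset ℂ, p.1 ≠ p.2 →
      ∀ x, x ≠ 0 → aEig q η p.1 x = aEig q η p.2 x → x ^ 2 ∈ s := by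
    intro p
    by_cases hp : p.1 = p.2
    · exact ⟨∅, fun h => absurd hp h⟩
    · obtain ⟨s, hs⟩ := (isEvenLaurent_aEig hq hη p.1).finite_eq (isEvenLaurent_aEig hq hη p.2)
        (hg.aEig_injective hq hq1 hη hp)
      exact ⟨s, fun _ => hs⟩
  choose s hs using key
  obtain ⟨x, hx, hxs⟩ := exists_ne_zero_sq_notMem (Finset.univ.biUnion s)
  refine ⟨x, hx, fun h k e => ?_⟩
  by_contra hne
  exact hxs (Finset.mem_biUnion.2 ⟨(h, k), Finset.mem_univ _, hs (h, k) hne x hx e⟩)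

/-- Away from finitely many squares no eigenvalue vanishes. -/
theorem exists_finset_aEig_ne_zero (hq : q ≠ 0) (hη : ∀ n, η n ≠ 0) :
    ∃ s : Finset ℂ, ∀ x, x ≠ 0 → x ^ 2 ∉ s → ∀ h, aEig q η h x ≠ 0 := by
  refine ⟨Finset.univ.biUnion fun h : Fin N → Fin 2 =>
    Finset.univ.image fun n => node q η h n ^ 2, fun x hx hxs h h0 => hxs ?_⟩
  rw [aEig_eq_zeroProd hq, zeroProd, Finset.prod_eq_zero_iff] at h0
  obtain ⟨n, -, hn⟩ := h0
  rw [(sn_div_eq_zero_iff hx (node_ne_zero hq hη h n)).1 hn]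
  exact Finset.mem_biUnion.2 ⟨h, Finset.mem_univ _, Finset.mem_image_of_mem _ (Finset.mem_univ n)⟩

/-- Continuous functions on `ℂ \ {0}` that agree away from finitely many squares agree. -/
theorem eqOn_of_continuousOn {X : Type*} [TopologicalSpace X] [T2Space X] {f g : ℂ → X}
    (hf : ContinuousOn f {0}ᶜ) (hg : ContinuousOn g {0}ᶜ) (s : Finset ℂ)
    (h : ∀ x, x ≠ 0 → x ^ 2 ∉ s → f x = g x) : Set.EqOn f g {0}ᶜ := by
  -- The point `0` is added so that the dense set `tᶜ` lies inside `ℂ \ {0}`.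
  set t : Set ℂ := ((fun x : ℂ => x ^ 2) ⁻¹' (insert 0 s : Finset ℂ)) with ht
  have hfin : t.Finite := by
    refine Set.Finite.preimage' (Finset.finite_toSet _) fun b _ => ?_
    refine ((Polynomial.nthRoots 2 b).toFinset.finite_toSet).subset fun x hx => ?_
    simpa [Polynomial.mem_nthRoots] using hx
  have hdense : Dense tᶜ := hfin.countable.dense_compl ℂ
  have hsub : tᶜ ⊆ ({0}ᶜ : Set ℂ) := by
    intro x hx h0
    rw [Set.mem_singleton_iff] at h0
    exact hx (by simp [ht, h0])
  refine Set.EqOn.of_subset_closure (s := tᶜ) (fun x hx => ?_) hf hg hsub fun x _ => hdense x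
  refine h x (hsub hx) fun h' => hx ?_
  simp only [ht, Set.mem_preimage, Finset.coe_insert, Set.mem_insert_iff]
  exact Or.inr h'

/-! ### Separation of variables for a triple of operator families -/

theorem conf_induction {p : (Fin N → Fin 2) → Prop} (h0 : p fun _ => 0)
    (hs : ∀ h a, h a = 0 → p h → p (Function.update h a 1)) (h : Fin N → Fin 2) : p h := by
  have key : ∀ s : Finset (Fin N), p fun n => if n ∈ s then 1 else 0 := by
    intro s
    induction s using Finset.induction_on with
    | empty => simpa using h0
    | insert a s ha ih =>
      convert hs _ a (by simp [ha]) ih using 1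
      ext n
      by_cases hn : n = a
      · subst hn; simp
      · simp [hn]
  convert key (Finset.univ.filter fun n => h n = 1) using 1
  ext n
  rcases Fin.exists_fin_two.1 ⟨h n, rfl⟩ with hn | hn <;> simp [hn]

/-- `A` is to be diagonalized, `P` raises and `Q` lowers the separated variables, and `ψ` is the
family of states generated from `ψ 0` by `P`. -/
structure IsSeparating {N : ℕ} (q : ℂ) (η : Fin N → ℂ) (A P Q : ℂ → Op N) (α β : Fin N → ℂ)
    (ψ : (Fin N → Fin 2) → Conf N → ℂ) : Prop where
  α_ne : ∀ a, α a ≠ 0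
  β_ne : ∀ a, β a ≠ 0
  laurentA : ∀ s t, IsEvenLaurent N fun x => A x s t
  laurentP : ∀ s t, IsOddLaurent N fun x => P x s t
  laurentQ : ∀ s t, IsOddLaurent N fun x => Q x s t
  exchangeP : ∀ x y, x ≠ 0 → y ≠ 0 →
    sn (x / y) • (A x * P y) = sn (x / (y * q)) • (P y * A x) + sn q • (P x * A y)
  exchangeQ : ∀ x y, x ≠ 0 → y ≠ 0 →
    sn (x / y) • (A x * Q y) = sn (x / (y / q)) • (Q y * A x) + (-sn q) • (Q x * A y)
  qdet : ∀ a, ∃ K, Q (η a) * P (η a / q) = K * A (η a / q) + (α a * β a) • 1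
  ref : ∀ x, x ≠ 0 → A x *ᵥ ψ (fun _ => 0) = aEig q η (fun _ => 0) x • ψ (fun _ => 0)
  ref_ne : ψ (fun _ => 0) ≠ 0
  step : ∀ h a, h a = 0 → P (η a / q) *ᵥ ψ h = α a • ψ (Function.update h a 1)

theorem continuousOn_mulVec {A : ℂ → Op N} (hA : ∀ s t, IsEvenLaurent N fun x => A x s t)
    (v : Conf N → ℂ) : ContinuousOn (fun x => A x *ᵥ v) {0}ᶜ := by
  rw [continuousOn_pi]
  intro s
  exact continuousOn_finsetSum _ fun t _ => (hA s t).continuousOn.mul continuousOn_const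

/-- A family `R` with an exchange relation with `A` moves a zero of the eigenvalue. -/
theorem mulVec_mulVec_of_exchange {A R : ℂ → Op N} (hA : ∀ s t, IsEvenLaurent N fun x => A x s t)
    {ζ : Fin N → ℂ} (hζ : ∀ n, ζ n ≠ 0) (a : Fin N) {z c : ℂ} (hz : z ≠ 0)
    (hR : ∀ x, x ≠ 0 → sn (x / ζ a) • (A x * R (ζ a))
      = sn (x / z) • (R (ζ a) * A x) + c • (R x * A (ζ a)))
    {v : Conf N → ℂ} (hv : ∀ x, x ≠ 0 → A x *ᵥ v = zeroProd ζ x • v) {x : ℂ} (hx : x ≠ 0) :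
    A x *ᵥ (R (ζ a) *ᵥ v) = zeroProd (Function.update ζ a z) x • (R (ζ a) *ᵥ v) := by
  have hζ' : ∀ n, Function.update ζ a z n ≠ 0 := by
    intro n
    by_cases hn : n = a
    · subst hn; simpa using hz
    · simpa [hn] using hζ n
  -- The exchange relation can be divided by `sn (x / ζ a)` only off `x ^ 2 = ζ a ^ 2`; continuity
  -- supplies the remaining points.
  refine eqOn_of_continuousOn (continuousOn_mulVec hA _)
    ((isEvenLaurent_zeroProd hζ').continuousOn.smul continuousOn_const) {ζ a ^ 2}
    (fun x hx hxs => ?_) hx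
  have h0 : sn (x / ζ a) ≠ 0 := fun h =>
    hxs (Finset.mem_singleton.2 ((sn_div_eq_zero_iff hx (hζ a)).1 h))
  -- The unwanted term contains `A (ζ a) *ᵥ v`, which is zero.
  have h1 := congrArg (· *ᵥ v) (hR x hx)
  simp only [Matrix.add_mulVec, Matrix.smul_mulVec, ← Matrix.mulVec_mulVec, hv x hx,
    hv _ (hζ a), Matrix.mulVec_smul, zeroProd_self hζ, zero_smul, smul_zero, add_zero,
    Matrix.mulVec_zero, smul_smul] at h1
  refine (smul_right_injective _ h0) ?_
  simp only [Pi.smul_apply']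
  rw [h1, smul_smul, zeroProd_update, zeroProd_eq_mul ζ a]
  congr 1
  ring

namespace IsSeparating

variable {A P Q : ℂ → Op N} {α β : Fin N → ℂ} {ψ : (Fin N → Fin 2) → Conf N → ℂ}

/-- Applying `P (η a / q)` multiplies the node `η a / q` by `q`, which gives exactly the node for `h
a = 1`. -/
theorem mulVec_eq (H : IsSeparating q η A P Q α β ψ) (hq : q ≠ 0) (hη : ∀ n, η n ≠ 0)
    (h : Fin N → Fin 2) {x : ℂ} (hx : x ≠ 0) : A x *ᵥ ψ h = zeroProd (node q η h) x • ψ h := by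
  revert x
  induction h using conf_induction with
  | h0 =>
    intro x hx
    rw [H.ref x hx, aEig_eq_zeroProd hq]
  | hs h a ha ih =>
    intro x hx
    have h1 := mulVec_mulVec_of_exchange H.laurentA (node_ne_zero hq hη h) a
      (mul_ne_zero (node_ne_zero hq hη h a) hq)
      (fun x hx => H.exchangeP x _ hx (node_ne_zero hq hη h a)) (fun x hx => ih hx) hx
    rw [node_of_eq_zero ha, H.step h a ha, div_mul_cancel₀ _ hq, Matrix.mulVec_smul,
      smul_comm] at h1
    rw [smul_right_injective _ (H.α_ne a) h1, node_update]
    simp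

theorem mulVec_node_eq_zero (H : IsSeparating q η A P Q α β ψ) (hq : q ≠ 0) (hη : ∀ n, η n ≠ 0)
    {h : Fin N → Fin 2} {a : Fin N} (ha : h a = 0) : A (η a / q) *ᵥ ψ h = 0 := by
  rw [H.mulVec_eq hq hη h (div_ne_zero (hη a) hq), ← node_of_eq_zero ha,
    zeroProd_self (node_ne_zero hq hη h), zero_smul]

/-- On `ψ h` the term `K * A (η a / q)` of the quantum determinant vanishes because `η a / q` is a
node of `h`. -/
theorem lower_raise (H : IsSeparating q η A P Q α β ψ) (hq : q ≠ 0) (hη : ∀ n, η n ≠ 0)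
    {h : Fin N → Fin 2} {a : Fin N} (ha : h a = 0) :
    Q (η a) *ᵥ ψ (Function.update h a 1) = β a • ψ h := by
  obtain ⟨K, hK⟩ := H.qdet a
  have h1 := congrArg (· *ᵥ ψ h) hK
  simp only [Matrix.add_mulVec, Matrix.smul_mulVec, ← Matrix.mulVec_mulVec, H.step h a ha,
    H.mulVec_node_eq_zero hq hη ha, Matrix.mulVec_zero, zero_add, Matrix.one_mulVec,
    Matrix.mulVec_smul, mul_smul] at h1
  exact smul_right_injective _ (H.α_ne a) h1

theorem ne_zero (H : IsSeparating q η A P Q α β ψ) (hq : q ≠ 0) (hη : ∀ n, η n ≠ 0)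
    (h : Fin N → Fin 2) : ψ h ≠ 0 := by
  induction h using conf_induction with
  | h0 => exact H.ref_ne
  | hs h a ha ih =>
    intro h0
    have h1 := H.lower_raise hq hη ha
    rw [h0, Matrix.mulVec_zero, eq_comm, smul_eq_zero] at h1
    exact h1.elim (H.β_ne a) ih

theorem linearIndependent (H : IsSeparating q η A P Q α β ψ) (hg : IsGeneric q η) (hq : q ≠ 0)
    (hq1 : q ^ 2 ≠ 1) (hη : ∀ n, η n ≠ 0) : LinearIndependent ℂ ψ := by
  obtain ⟨x, hx, hinj⟩ := hg.exists_injective_aEig hq hq1 hη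
  refine Module.End.eigenvectors_linearIndependent' (Matrix.toLin' (A x)) _ hinj ψ fun h => ?_
  rw [Module.End.hasEigenvector_iff, Module.End.mem_eigenspace_iff]
  exact ⟨by rw [Matrix.toLin'_apply, H.mulVec_eq hq hη h hx, aEig_eq_zeroProd hq],
    H.ne_zero hq hη h⟩

theorem span_eq_top (H : IsSeparating q η A P Q α β ψ) (hg : IsGeneric q η) (hq : q ≠ 0)
    (hq1 : q ^ 2 ≠ 1) (hη : ∀ n, η n ≠ 0) : Submodule.span ℂ (Set.range ψ) = ⊤ :=
  (H.linearIndependent hg hq hq1 hη).span_eq_top_of_card_eq_finrank' (by simp)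

/-- A joint eigenvector whose eigenvalue is none of the `aEig q η k` vanishes. -/
theorem eq_zero_of_forall_ne (H : IsSeparating q η A P Q α β ψ) (hg : IsGeneric q η) (hq : q ≠ 0)
    (hq1 : q ^ 2 ≠ 1) (hη : ∀ n, η n ≠ 0) {v : Conf N → ℂ} {f : ℂ → ℂ}
    (hv : ∀ x, x ≠ 0 → A x *ᵥ v = f x • v)
    (hf : ∀ k, ∃ x, x ≠ 0 ∧ f x ≠ aEig q η k x) : v = 0 := by
  have hli := H.linearIndependent hg hq hq1 hη
  have hmem : v ∈ Submodule.span ℂ (Set.range ψ) := by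
    rw [H.span_eq_top hg hq hq1 hη]; trivial
  obtain ⟨c, rfl⟩ := (Submodule.mem_span_range_iff_exists_fun ℂ).1 hmem
  refine Finset.sum_eq_zero fun k _ => ?_
  obtain ⟨x, hx, hne⟩ := hf k
  have h1 := hv x hx
  simp only [Matrix.mulVec_sum, Matrix.mulVec_smul, H.mulVec_eq hq hη _ hx,
    ← aEig_eq_zeroProd hq, Finset.smul_sum] at h1
  rw [← sub_eq_zero, ← Finset.sum_sub_distrib] at h1
  have h2 : ∑ k, (c k * (aEig q η k x - f x)) • ψ k = 0 := by
    rw [← h1]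
    refine Finset.sum_congr rfl fun k _ => ?_
    module
  have h3 := Fintype.linearIndependent_iff.1 hli _ h2 k
  rw [(mul_eq_zero.1 h3).resolve_right (sub_ne_zero.2 hne.symm), zero_smul]

/-- The result would be a joint eigenvector with a node at `η a * q`, which is neither `η a / q` nor
`η a` as `q ^ 2 ≠ 1`. -/
theorem raise_eq_zero (H : IsSeparating q η A P Q α β ψ) (hg : IsGeneric q η) (hq : q ≠ 0)
    (hq1 : q ^ 2 ≠ 1) (hη : ∀ n, η n ≠ 0) {h : Fin N → Fin 2} {a : Fin N} (ha : h a = 1) :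
    P (η a) *ᵥ ψ h = 0 := by
  refine H.eq_zero_of_forall_ne hg hq hq1 hη
    (f := zeroProd (Function.update (node q η h) a (η a * q))) (fun x hx => ?_) fun k => ?_
  · have h1 := mulVec_mulVec_of_exchange H.laurentA (node_ne_zero hq hη h) a
      (mul_ne_zero (node_ne_zero hq hη h a) hq)
      (fun x hx => H.exchangeP x _ hx (node_ne_zero hq hη h a))
      (fun x hx => H.mulVec_eq hq hη h hx) hx
    rwa [node_of_eq_one ha] at h1
  · by_contra! e
    have h1 := hg.eq_node hq hq1 hη (mul_ne_zero (hη a) hq) e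
    rcases Fin.exists_fin_two.1 ⟨k a, rfl⟩ with hk | hk
    · rw [node_of_eq_zero hk, eq_div_iff hq, mul_assoc, mul_eq_left₀ (hη a), ← sq] at h1
      exact hq1 h1
    · rw [node_of_eq_one hk, mul_eq_left₀ (hη a)] at h1
      exact hq1 (by rw [h1, one_pow])

/-- As for raising, with the forbidden node `η a / q ^ 2`. -/
theorem lower_eq_zero (H : IsSeparating q η A P Q α β ψ) (hg : IsGeneric q η) (hq : q ≠ 0)
    (hq1 : q ^ 2 ≠ 1) (hη : ∀ n, η n ≠ 0) {h : Fin N → Fin 2} {a : Fin N} (ha : h a = 0) :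
    Q (η a / q) *ᵥ ψ h = 0 := by
  refine H.eq_zero_of_forall_ne hg hq hq1 hη
    (f := zeroProd (Function.update (node q η h) a (η a / q / q))) (fun x hx => ?_) fun k => ?_
  · have h1 := mulVec_mulVec_of_exchange H.laurentA (node_ne_zero hq hη h) a
      (div_ne_zero (node_ne_zero hq hη h a) hq)
      (fun x hx => H.exchangeQ x _ hx (node_ne_zero hq hη h a))
      (fun x hx => H.mulVec_eq hq hη h hx) hx
    rwa [node_of_eq_zero ha] at h1
  · by_contra! e
    have h1 := hg.eq_node hq hq1 hη (div_ne_zero (div_ne_zero (hη a) hq) hq) e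
    rcases Fin.exists_fin_two.1 ⟨k a, rfl⟩ with hk | hk
    · rw [node_of_eq_zero hk, div_eq_iff hq, eq_comm,
        mul_eq_left₀ (div_ne_zero (hη a) hq)] at h1
      exact hq1 (by rw [h1, one_pow])
    · rw [node_of_eq_one hk, div_div, div_eq_iff (mul_ne_zero hq hq), eq_comm,
        mul_eq_left₀ (hη a), ← sq] at h1
      exact hq1 h1

/-- The nodes of `h` have distinct squares, and `interp` is their Lagrange coefficient.
Interpolating at the nodes of `h` itself is what makes every term computable on `ψ h`. -/
theorem _root_.XXZ.mulVec_eq_sum_interp {R : ℂ → Op N}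
    (hR : ∀ s t, IsOddLaurent N fun x => R x s t) (hg : IsGeneric q η) (hq : q ≠ 0)
    (hq1 : q ^ 2 ≠ 1) (hη : ∀ n, η n ≠ 0) (h : Fin N → Fin 2) (v : Conf N → ℂ) {x : ℂ}
    (hx : x ≠ 0) : R x *ᵥ v = ∑ a, interp q η h a x • (R (node q η h a) *ᵥ v) := by
  have h1 : R x = ∑ a, interp q η h a x • R (node q η h a) := by
    ext s t
    rw [(hR s t).interpolate (node_ne_zero hq hη h)
      (fun a b hab e => hab (hg.eq_of_node_sq_eq hq hq1 hη e).1) hx, Matrix.sum_apply]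
    simp only [interp_eq hq, Matrix.smul_apply, smul_eq_mul]
  rw [h1, Matrix.sum_mulVec]
  simp only [Matrix.smul_mulVec]

theorem raise (H : IsSeparating q η A P Q α β ψ) (hg : IsGeneric q η) (hq : q ≠ 0)
    (hq1 : q ^ 2 ≠ 1) (hη : ∀ n, η n ≠ 0) (h : Fin N → Fin 2) {x : ℂ} (hx : x ≠ 0) :
    P x *ᵥ ψ h = ∑ a, (interp q η h a x * α a) • shiftUp ψ a h := by
  rw [mulVec_eq_sum_interp H.laurentP hg hq hq1 hη h _ hx]
  refine Finset.sum_congr rfl fun a _ => ?_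
  rw [mul_smul]
  congr 1
  rcases Fin.exists_fin_two.1 ⟨h a, rfl⟩ with ha | ha
  · rw [node_of_eq_zero ha, H.step h a ha, shiftUp, if_pos ha]
  · rw [node_of_eq_one ha, H.raise_eq_zero hg hq hq1 hη ha, shiftUp,
      if_neg (by rw [ha]; decide), smul_zero]

theorem lower (H : IsSeparating q η A P Q α β ψ) (hg : IsGeneric q η) (hq : q ≠ 0)
    (hq1 : q ^ 2 ≠ 1) (hη : ∀ n, η n ≠ 0) (h : Fin N → Fin 2) {x : ℂ} (hx : x ≠ 0) :
    Q x *ᵥ ψ h = ∑ a, (interp q η h a x * β a) • shiftDown ψ a h := by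
  rw [mulVec_eq_sum_interp H.laurentQ hg hq hq1 hη h _ hx]
  refine Finset.sum_congr rfl fun a _ => ?_
  rw [mul_smul]
  congr 1
  rcases Fin.exists_fin_two.1 ⟨h a, rfl⟩ with ha | ha
  · rw [node_of_eq_zero ha, H.lower_eq_zero hg hq hq1 hη ha, shiftDown,
      if_neg (by rw [ha]; decide), smul_zero]
  · have h1 := H.lower_raise hq hη (h := Function.update h a 0) (a := a) (by simp)
    rw [Function.update_idem, ← ha, Function.update_eq_self] at h1
    rw [node_of_eq_one ha, h1, shiftDown, if_pos ha]

end IsSeparating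

/-! ### The Yang-Baxter algebra -/

theorem sn_div_swap (x y : ℂ) : sn (y / x) = -sn (x / y) := by rw [← sn_inv, inv_div]

/-- This and the next three relations put the exchange algebra into the form of `exchangeP` and
`exchangeQ`. Those with `A(x)` on the right serve the left representation, after transposition. -/
theorem exchange_CA (hq : q ≠ 0) (hη : ∀ n, η n ≠ 0) {x y : ℂ} (hx : x ≠ 0) (hy : y ≠ 0) :
    sn (x / y) • (opC q η y * opA q η x)
      = sn (x / (y * q)) • (opA q η x * opC q η y) + sn q • (opA q η y * opC q η x) := by
  have h := (isExchange_monodromy hq hη hy hx).entries.2.1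
  rw [div_mul_eq_mul_div, sn_div_swap x, sn_div_swap x, neg_smul, neg_smul, neg_add_eq_iff_eq_add,
    ← sub_eq_add_neg, eq_sub_iff_add_eq, add_comm] at h
  exact h.symm

theorem exchange_BA (hq : q ≠ 0) (hη : ∀ n, η n ≠ 0) {x y : ℂ} (hx : x ≠ 0) (hy : y ≠ 0) :
    sn (x / y) • (opB q η y * opA q η x)
      = sn (x / (y / q)) • (opA q η x * opB q η y) + (-sn q) • (opA q η y * opB q η x) := by
  have h := (isExchange_monodromy hq hη hx hy).entries.2.2.1
  rw [div_mul_eq_mul_div, ← sub_eq_iff_eq_add] at h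
  rw [div_div_eq_mul_div, neg_smul, ← sub_eq_add_neg]
  exact h.symm

theorem exchange_AB (hq : q ≠ 0) (hη : ∀ n, η n ≠ 0) {x y : ℂ} (hx : x ≠ 0) (hy : y ≠ 0) :
    sn (x / y) • (opA q η x * opB q η y)
      = sn (x / (y * q)) • (opB q η y * opA q η x) + sn q • (opB q η x * opA q η y) := by
  have h := (isExchange_monodromy hq hη hy hx).entries.2.2.2.1
  rw [div_mul_eq_mul_div, sn_div_swap x, sn_div_swap x, neg_smul, neg_smul, eq_neg_add_iff_add_eq,
    ← sub_eq_add_neg, sub_eq_iff_eq_add, add_comm] at h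
  exact h

theorem exchange_AC (hq : q ≠ 0) (hη : ∀ n, η n ≠ 0) {x y : ℂ} (hx : x ≠ 0) (hy : y ≠ 0) :
    sn (x / y) • (opA q η x * opC q η y)
      = sn (x / (y / q)) • (opC q η y * opA q η x) + (-sn q) • (opC q η x * opA q η y) := by
  have h := (isExchange_monodromy hq hη hx hy).entries.1
  rw [div_mul_eq_mul_div, ← eq_sub_iff_add_eq] at h
  rw [div_div_eq_mul_div, neg_smul, ← sub_eq_add_neg]
  exact h

/-- For arguments `η a / q` and `η b / q` the factor to be cancelled is `sn (η a * q / η b)`,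
nonzero by genericity. -/
theorem commute_opC (hq : q ≠ 0) (hη : ∀ n, η n ≠ 0) {x y : ℂ} (hx : x ≠ 0) (hy : y ≠ 0)
    (h : sn (x / y * q) ≠ 0) : Commute (opC q η x) (opC q η y) :=
  smul_right_injective _ h (isExchange_monodromy hq hη hx hy).entries.2.2.2.2.1

theorem commute_opB (hq : q ≠ 0) (hη : ∀ n, η n ≠ 0) {x y : ℂ} (hx : x ≠ 0) (hy : y ≠ 0)
    (h : sn (x / y * q) ≠ 0) : Commute (opB q η x) (opB q η y) :=
  smul_right_injective _ h (isExchange_monodromy hq hη hx hy).entries.2.2.2.2.2.1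

/-! ### Nonvanishing at generic inhomogeneities -/

theorem IsGeneric.sn_mul_div_ne_zero (hg : IsGeneric q η) (hq : q ≠ 0) (hq1 : q ^ 2 ≠ 1)
    (hη : ∀ n, η n ≠ 0) (a b : Fin N) : sn (η a * q / η b) ≠ 0 := by
  rw [Ne, sn_div_eq_zero_iff (mul_ne_zero (hη a) hq) (hη b), mul_pow]
  intro h
  by_cases hab : a = b
  · subst hab
    exact hq1 ((mul_eq_left₀ (pow_ne_zero 2 (hη a))).1 h)
  · exact hg b a (Ne.symm hab) 1 (by simp) (by rw [zpow_one, mul_pow, ← h, mul_comm])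

theorem IsGeneric.sn_div_div_ne_zero (hg : IsGeneric q η) (hq : q ≠ 0) (hq1 : q ^ 2 ≠ 1)
    (hη : ∀ n, η n ≠ 0) (a b : Fin N) : sn (η a / q / η b) ≠ 0 := by
  have h := hg.sn_mul_div_ne_zero hq hq1 hη b a
  rwa [← inv_div, sn_inv, neg_ne_zero, mul_comm, ← div_div] at h

theorem IsGeneric.aFun_ne_zero (hg : IsGeneric q η) (hq : q ≠ 0) (hq1 : q ^ 2 ≠ 1)
    (hη : ∀ n, η n ≠ 0) (a : Fin N) : aFun q η (η a) ≠ 0 :=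
  neg_ne_zero.2 (Finset.prod_ne_zero_iff.2 fun b _ => hg.sn_mul_div_ne_zero hq hq1 hη a b)

theorem IsGeneric.dFun_ne_zero (hg : IsGeneric q η) (hq : q ≠ 0) (hq1 : q ^ 2 ≠ 1)
    (hη : ∀ n, η n ≠ 0) (a : Fin N) : dFun η (η a / q) ≠ 0 :=
  Finset.prod_ne_zero_iff.2 fun b _ => hg.sn_div_div_ne_zero hq hq1 hη a b

theorem IsGeneric.normSq_ne_zero (hg : IsGeneric q η) (hη : ∀ n, η n ≠ 0) : normSq η ≠ 0 := by
  refine Finset.prod_ne_zero_iff.2 fun a _ => Finset.prod_ne_zero_iff.2 fun b hb h => ?_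
  rw [sn_div_eq_zero_iff (hη a) (hη b)] at h
  exact hg a b (Finset.mem_filter.1 hb).2.ne' 0 (by simp) (by simpa using h)

/-! ### The separated states -/

theorem prod_ofFn_update {M : Type*} [Monoid M] {n : ℕ} {g : Fin n → M}
    (hc : ∀ i j, Commute (g i) (g j)) (h : Fin n → Fin 2) {a : Fin n} (ha : h a = 0) :
    (List.ofFn fun i => g i ^ (Function.update h a 1 i : ℕ)).prod
      = g a * (List.ofFn fun i => g i ^ (h i : ℕ)).prod := by
  induction n with
  | zero => exact a.elim0
  | succ n ih =>
    simp only [List.ofFn_succ, List.prod_cons]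
    induction a using Fin.cases with
    | zero => simp [ha]
    | succ a =>
      have h1 : ∀ i : Fin n, Function.update h a.succ 1 i.succ
          = Function.update (fun i => h i.succ) a 1 i := by
        intro i
        by_cases hi : i = a
        · subst hi; simp
        · simp [hi]
      simp only [h1, Function.update_of_ne (Fin.succ_ne_zero a).symm]
      rw [ih (g := fun i => g i.succ) (fun i j => hc _ _) (fun i => h i.succ) ha, ← mul_assoc,
        ← mul_assoc, ((hc 0 a.succ).pow_left _).eq]

theorem commute_prod_ofFn {M : Type*} [Monoid M] {n : ℕ} {g : Fin n → M}
    (hc : ∀ i j, Commute (g i) (g j)) (h : Fin n → Fin 2) (a : Fin n) :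
    Commute (g a) (List.ofFn fun i => g i ^ (h i : ℕ)).prod := by
  refine Commute.list_prod_right _ _ fun y hy => ?_
  obtain ⟨i, rfl⟩ := (List.mem_ofFn' _ _).1 hy
  exact (hc a i).pow_right _

theorem commute_smul_opC (hg : IsGeneric q η) (hq : q ≠ 0) (hq1 : q ^ 2 ≠ 1) (hη : ∀ n, η n ≠ 0)
    (a b : Fin N) : Commute ((dFun η (η a / q))⁻¹ • opC q η (η a / q))
      ((dFun η (η b / q))⁻¹ • opC q η (η b / q)) := by
  refine Commute.smul_left (Commute.smul_right (commute_opC hq hη (div_ne_zero (hη a) hq)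
    (div_ne_zero (hη b) hq) ?_) _) _
  rw [div_div_div_cancel_right₀ hq, div_mul_eq_mul_div]
  exact hg.sn_mul_div_ne_zero hq hq1 hη a b

theorem commute_smul_opB (hg : IsGeneric q η) (hq : q ≠ 0) (hq1 : q ^ 2 ≠ 1) (hη : ∀ n, η n ≠ 0)
    (a b : Fin N) : Commute ((aFun q η (η a))⁻¹ • opB q η (η a / q))
      ((aFun q η (η b))⁻¹ • opB q η (η b / q)) := by
  refine Commute.smul_left (Commute.smul_right (commute_opB hq hη (div_ne_zero (hη a) hq)
    (div_ne_zero (hη b) hq) ?_) _) _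
  rw [div_div_div_cancel_right₀ hq, div_mul_eq_mul_div]
  exact hg.sn_mul_div_ne_zero hq hq1 hη a b

theorem leftState_zero (nrm : ℂ) : leftState q η nrm (fun _ => 0) = nrm⁻¹ • refState N := by
  simp [leftState]

theorem rightState_zero (nrm : ℂ) : rightState q η nrm (fun _ => 0) = nrm⁻¹ • refState N := by
  simp [rightState]

theorem refState_ne_zero : refState N ≠ 0 := by
  simp [refState]

theorem aEig_zero (x : ℂ) : aEig q η (fun _ => 0) x = ∏ n, sn (x * q / η n) := by
  simp [aEig, hInt]

theorem isSeparating_right (hg : IsGeneric q η) (hq : q ≠ 0) (hq1 : q ^ 2 ≠ 1)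
    (hη : ∀ n, η n ≠ 0) {nrm : ℂ} (hn : nrm ≠ 0) :
    IsSeparating q η (opA q η) (opB q η) (opC q η) (fun a => aFun q η (η a))
      (fun a => dFun η (η a / q)) (rightState q η nrm) where
  α_ne := hg.aFun_ne_zero hq hq1 hη
  β_ne := hg.dFun_ne_zero hq hq1 hη
  laurentA s t := (isLaurent_monodromy hq hη s t).1
  laurentP s t := (isLaurent_monodromy hq hη s t).2.1
  laurentQ s t := (isLaurent_monodromy hq hη s t).2.2.1
  exchangeP _ _ hx hy := exchange_AB hq hη hx hy
  exchangeQ _ _ hx hy := exchange_AC hq hη hx hy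
  qdet a := ⟨opD q η (η a), by
    have h := qdet_DA hq hη (hη a)
    rw [neg_smul, sub_eq_iff_eq_add, neg_add_eq_sub, eq_sub_iff_add_eq] at h
    rw [h]⟩
  ref x _ := by
    rw [rightState_zero, Matrix.mulVec_smul, opA_mulVec_refState, aEig_zero, smul_comm]
  ref_ne := by
    rw [rightState_zero]
    exact smul_ne_zero (inv_ne_zero hn) refState_ne_zero
  step h a ha := by
    have h0 := hg.aFun_ne_zero hq hq1 hη a
    rw [rightState, rightState, prod_ofFn_update (commute_smul_opB hg hq hq1 hη) h ha,
      ← Matrix.mulVec_mulVec, Matrix.smul_mulVec, Matrix.mulVec_smul, smul_comm _ nrm⁻¹,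
      smul_inv_smul₀ h0]

/-- Covectors are vectors for the transposed operators. Transposition reverses products, so `C`
raises, `B` lowers, and the quantum determinant is needed in the form `qdet_AD'`. -/
theorem isSeparating_left (hg : IsGeneric q η) (hq : q ≠ 0) (hq1 : q ^ 2 ≠ 1)
    (hη : ∀ n, η n ≠ 0) {nrm : ℂ} (hn : nrm ≠ 0) :
    IsSeparating q η (fun x => (opA q η x)ᵀ) (fun x => (opC q η x)ᵀ) (fun x => (opB q η x)ᵀ)
      (fun a => dFun η (η a / q)) (fun a => aFun q η (η a)) (leftState q η nrm) where
  α_ne := hg.dFun_ne_zero hq hq1 hη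
  β_ne := hg.aFun_ne_zero hq hq1 hη
  laurentA s t := (isLaurent_monodromy hq hη t s).1
  laurentP s t := (isLaurent_monodromy hq hη t s).2.2.1
  laurentQ s t := (isLaurent_monodromy hq hη t s).2.1
  exchangeP x y hx hy := by
    have h := congrArg Matrix.transpose (exchange_CA hq hη hx hy)
    simpa only [Matrix.transpose_add, Matrix.transpose_smul, Matrix.transpose_mul] using h
  exchangeQ x y hx hy := by
    have h := congrArg Matrix.transpose (exchange_BA hq hη hx hy)
    simpa only [Matrix.transpose_add, Matrix.transpose_smul, Matrix.transpose_mul] using h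
  qdet a := ⟨(opD q η (η a))ᵀ, by
    have h := qdet_AD' hq hq1 hη (hη a)
    rw [neg_smul, sub_eq_iff_eq_add, neg_add_eq_sub, eq_sub_iff_add_eq] at h
    rw [← Matrix.transpose_mul, ← Matrix.transpose_mul, ← h, mul_comm (dFun _ _),
      Matrix.transpose_add, Matrix.transpose_smul, Matrix.transpose_one]⟩
  ref x _ := by
    rw [leftState_zero, Matrix.mulVec_transpose, Matrix.smul_vecMul, refState_vecMul_opA,
      aEig_zero, smul_comm]
  ref_ne := by
    rw [leftState_zero]
    exact smul_ne_zero (inv_ne_zero hn) refState_ne_zero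
  step h a ha := by
    have h0 := hg.dFun_ne_zero hq hq1 hη a
    have hc := commute_smul_opC hg hq hq1 hη
    rw [leftState, leftState, prod_ofFn_update hc h ha, (commute_prod_ofFn hc h a).eq,
      ← Matrix.vecMul_vecMul, Matrix.vecMul_smul, Matrix.mulVec_transpose, Matrix.smul_vecMul,
      smul_comm _ nrm⁻¹, smul_inv_smul₀ h0]

/-- Coefficients matter only where the shifted state exists. This lets the constants `α a` be
replaced by the functions of `h a` in the theorem. -/
theorem smul_shiftUp_congr {V : Type*} [AddCommMonoid V] [Module ℂ V]
    {ψ : (Fin N → Fin 2) → V} {a : Fin N} {h : Fin N → Fin 2} {c d : ℂ} (hcd : h a = 0 → c = d) :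
    c • shiftUp ψ a h = d • shiftUp ψ a h := by
  by_cases ha : h a = 0
  · rw [hcd ha]
  · simp [shiftUp, ha]

theorem smul_shiftDown_congr {V : Type*} [AddCommMonoid V] [Module ℂ V]
    {ψ : (Fin N → Fin 2) → V} {a : Fin N} {h : Fin N → Fin 2} {c d : ℂ} (hcd : h a = 1 → c = d) :
    c • shiftDown ψ a h = d • shiftDown ψ a h := by
  by_cases ha : h a = 1
  · rw [hcd ha]
  · simp [shiftDown, ha]

/-- If a spanning family of covectors consists of eigenvectors of `A` with nonzero eigenvalues,
then multiplication by `A` on the left is injective. -/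
theorem mul_left_cancel_of_vecMul {ι : Type*} {A Y Z : Op N} {ψ : ι → Conf N → ℂ} {c : ι → ℂ}
    (hspan : Submodule.span ℂ (Set.range ψ) = ⊤) (hA : ∀ i, ψ i ᵥ* A = c i • ψ i)
    (hc : ∀ i, c i ≠ 0) (h : A * Y = A * Z) : Y = Z := by
  have h1 : Y.vecMulLinear = Z.vecMulLinear := by
    refine LinearMap.ext_on_range hspan fun i => smul_right_injective _ (hc i) ?_
    simp only [Matrix.vecMulLinear_apply]
    rw [← Matrix.smul_vecMul, ← Matrix.smul_vecMul, ← hA, Matrix.vecMul_vecMul,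
      Matrix.vecMul_vecMul, h]
  ext s t
  have h2 := congrFun (LinearMap.congr_fun h1 (Pi.single s 1)) t
  simpa using h2

end XXZ

end

theorem mainTheorem11 (N : ℕ) (q : ℂ) (η : Fin N → ℂ) (hq0 : q ≠ 0) (hq1 : q ^ 2 ≠ 1)
    (hη : ∀ n, η n ≠ 0)
    (hSOV : ∀ a b : Fin N, a < b → ∀ j ∈ ({-1, 0, 1} : Set ℤ),
      η a ≠ q ^ j * η b ∧ η a ≠ -(q ^ j * η b))
    (nrm : ℂ) (hnrm : nrm ^ 2 = XXZ.normSq η) :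
    -- the left representation
    (LinearIndependent ℂ (XXZ.leftState q η nrm) ∧
      Submodule.span ℂ (Set.range (XXZ.leftState q η nrm)) = ⊤ ∧
      ∀ (h : Fin N → Fin 2) (x : ℂ), x ≠ 0 →
        XXZ.leftState q η nrm h ᵥ* XXZ.opA q η x
          = XXZ.aEig q η h x • XXZ.leftState q η nrm h ∧
        XXZ.leftState q η nrm h ᵥ* XXZ.opC q η x
          = ∑ a, (XXZ.interp q η h a x * XXZ.dFun η (η a * q ^ (XXZ.hInt h a - 1))) •
              XXZ.shiftUp (XXZ.leftState q η nrm) a h ∧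
        XXZ.leftState q η nrm h ᵥ* XXZ.opB q η x
          = ∑ a, (XXZ.interp q η h a x * XXZ.aFun q η (η a * q ^ (XXZ.hInt h a - 1))) •
              XXZ.shiftDown (XXZ.leftState q η nrm) a h) ∧
    -- the right representation
    (LinearIndependent ℂ (XXZ.rightState q η nrm) ∧
      Submodule.span ℂ (Set.range (XXZ.rightState q η nrm)) = ⊤ ∧
      ∀ (h : Fin N → Fin 2) (x : ℂ), x ≠ 0 →
        XXZ.opA q η x *ᵥ XXZ.rightState q η nrm h
          = XXZ.aEig q η h x • XXZ.rightState q η nrm h ∧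
        XXZ.opC q η x *ᵥ XXZ.rightState q η nrm h
          = ∑ a, (XXZ.interp q η h a x * XXZ.dFun η (η a * q ^ (-XXZ.hInt h a))) •
              XXZ.shiftDown (XXZ.rightState q η nrm) a h ∧
        XXZ.opB q η x *ᵥ XXZ.rightState q η nrm h
          = ∑ a, (XXZ.interp q η h a x * XXZ.aFun q η (η a * q ^ (-XXZ.hInt h a))) •
              XXZ.shiftUp (XXZ.rightState q η nrm) a h) ∧
    -- the eigenvalue functions of the eigenstates are pairwise distinct
    (∀ h k : Fin N → Fin 2, h ≠ k → ∃ x : ℂ, x ≠ 0 ∧ XXZ.aEig q η h x ≠ XXZ.aEig q η k x) ∧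
    -- the quantum determinant relation holds
    (∀ x : ℂ, x ≠ 0 →
      XXZ.opA q η x * XXZ.opD q η (x / q) - XXZ.opB q η x * XXZ.opC q η (x / q)
        = (-(XXZ.aFun q η x * XXZ.dFun η (x / q))) • (1 : XXZ.Op N)) ∧
    -- it determines the operator `D(x / q)` wherever `A(x)` has no zero eigenvalue
    (∀ x : ℂ, x ≠ 0 → (∀ h : Fin N → Fin 2, XXZ.aEig q η h x ≠ 0) → ∀ Y : XXZ.Op N,
      XXZ.opA q η x * Y - XXZ.opB q η x * XXZ.opC q η (x / q)
        = (-(XXZ.aFun q η x * XXZ.dFun η (x / q))) • (1 : XXZ.Op N) →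
      Y = XXZ.opD q η (x / q)) ∧
    -- and hence the whole function `D` among the continuous functions on `ℂ \ {0}`
    (∀ X : ℂ → XXZ.Op N, ContinuousOn X {0}ᶜ →
      (∀ x : ℂ, x ≠ 0 →
        XXZ.opA q η x * X (x / q) - XXZ.opB q η x * XXZ.opC q η (x / q)
          = (-(XXZ.aFun q η x * XXZ.dFun η (x / q))) • (1 : XXZ.Op N)) →
      ∀ x : ℂ, x ≠ 0 → X x = XXZ.opD q η x) := by
  have hg := XXZ.isGeneric_of_lt hq0 hSOV
  have hn : nrm ≠ 0 := by
    rintro rfl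
    exact hg.normSq_ne_zero hη (by rw [← hnrm]; simp)
  have HL := XXZ.isSeparating_left hg hq0 hq1 hη hn
  have HR := XXZ.isSeparating_right hg hq0 hq1 hη hn
  have hLA : ∀ (h : Fin N → Fin 2) (x : ℂ), x ≠ 0 → XXZ.leftState q η nrm h ᵥ* XXZ.opA q η x
      = XXZ.aEig q η h x • XXZ.leftState q η nrm h := fun h x hx => by
    rw [← Matrix.mulVec_transpose, HL.mulVec_eq hq0 hη h hx, XXZ.aEig_eq_zeroProd hq0]
  have huniq : ∀ x : ℂ, x ≠ 0 → (∀ h : Fin N → Fin 2, XXZ.aEig q η h x ≠ 0) → ∀ Y : XXZ.Op N,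
      XXZ.opA q η x * Y - XXZ.opB q η x * XXZ.opC q η (x / q)
        = (-(XXZ.aFun q η x * XXZ.dFun η (x / q))) • (1 : XXZ.Op N) →
      Y = XXZ.opD q η (x / q) := by
    intro x hx hx0 Y hY
    -- Comparison with the relation for `D` leaves `A(x) Y = A(x) D(x / q)`.
    rw [← XXZ.qdet_AD hq0 hη hx, sub_left_inj] at hY
    exact XXZ.mul_left_cancel_of_vecMul (HL.span_eq_top hg hq0 hq1 hη) (fun h => hLA h x hx)
      hx0 hY
  refine ⟨⟨HL.linearIndependent hg hq0 hq1 hη, HL.span_eq_top hg hq0 hq1 hη,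
      fun h x hx => ⟨hLA h x hx, ?_, ?_⟩⟩,
    ⟨HR.linearIndependent hg hq0 hq1 hη, HR.span_eq_top hg hq0 hq1 hη,
      fun h x hx => ⟨?_, ?_, ?_⟩⟩,
    fun h k hk => hg.aEig_injective hq0 hq1 hη hk, fun x hx => XXZ.qdet_AD hq0 hη hx, huniq, ?_⟩
  · rw [← Matrix.mulVec_transpose, HL.raise hg hq0 hq1 hη h hx]
    exact Finset.sum_congr rfl fun a _ => XXZ.smul_shiftUp_congr fun ha => by
      simp [XXZ.hInt, ha, div_eq_mul_inv]
  · rw [← Matrix.mulVec_transpose, HL.lower hg hq0 hq1 hη h hx]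
    exact Finset.sum_congr rfl fun a _ => XXZ.smul_shiftDown_congr fun ha => by
      simp [XXZ.hInt, ha]
  · rw [HR.mulVec_eq hq0 hη h hx, XXZ.aEig_eq_zeroProd hq0]
  · rw [HR.lower hg hq0 hq1 hη h hx]
    exact Finset.sum_congr rfl fun a _ => XXZ.smul_shiftDown_congr fun ha => by
      simp [XXZ.hInt, ha, div_eq_mul_inv]
  · rw [HR.raise hg hq0 hq1 hη h hx]
    exact Finset.sum_congr rfl fun a _ => XXZ.smul_shiftUp_congr fun ha => by
      simp [XXZ.hInt, ha]
  · intro X hX hrel x hx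
    obtain ⟨s, hs⟩ := XXZ.exists_finset_aEig_ne_zero (N := N) hq0 hη
    have hD : ContinuousOn (XXZ.opD q η) {0}ᶜ := by
      refine continuousOn_pi.2 fun s => continuousOn_pi.2 fun t => ?_
      exact (XXZ.isLaurent_monodromy hq0 hη s t).2.2.2.continuousOn
    -- The relation at `x * q` determines the value at `x`, so the exceptional squares are divided
    -- by `q ^ 2`.
    refine XXZ.eqOn_of_continuousOn hX hD (s.image fun y => y / q ^ 2) (fun x hx hxs => ?_) hx
    have hxq : x * q ≠ 0 := mul_ne_zero hx hq0
    have h1 := huniq (x * q) hxq (hs _ hxq fun hmem => hxs (Finset.mem_image.2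
      ⟨_, hmem, by rw [mul_pow, mul_div_cancel_right₀ _ (pow_ne_zero 2 hq0)]⟩)) _ (hrel _ hxq)
    rwa [mul_div_cancel_right₀ _ hq0] at h1
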